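/- Let $x_1, x_2, \dots$ be independent random variables with a common Gaussian distribution $N(m,v)$, $m\in\mathbb R$, $v>0$, and let $\mathcal T$ be a finite set of positive integers (lags). For $n$ larger than every element of $\mathcal T$ (and $n\ge 2$), let $\bar x_n=\frac1n\sum_{t=1}^n x_t$, let $s_n^2$ be the sample variance of $x_1,\dots,x_n$, with either of the usual divisors, i.e. $s_n^2=\frac1n\sum_{t=1}^n(x_t-\bar x_n)^2$ or $s_n^2=\frac1{n-1}\sum_{t=1}^n(x_t-\bar x_n)^2$, let $z_{t}=(x_t-\bar x_n)/s_n$ ($1\le t\le n$) be the standardized series, and set $$Q_n=n\sum_{\tau\in\mathcal T}\frac14\left(\frac1{n-\tau}\sum_{t=1}^{n-\tau}z_t^2z_{t+\tau}^2-1\right)^2 .$$ Then, as $n\to\infty$, $Q_n$ converges in distribution to the chi-squared distribution with $|\mathcal T|$ degrees of freedom, that is, to the law of the sum of the squares of $|\mathcal T|$ independent standard normal variables. -/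

import Mathlib

open MeasureTheory ProbabilityTheory Filter

/-- Sample mean of the first `n` terms `x 0, …, x (n - 1)` of a series. -/
noncomputable def sampleMean (n : ℕ) (x : ℕ → ℝ) : ℝ :=
  (∑ t ∈ Finset.range n, x t) / n

/-- Sample variance of the first `n` terms with divisor `n - d`: `d = 0` is the variance of the
empirical distribution, `d = 1` the unbiased sample variance. -/
noncomputable def sampleVar (d n : ℕ) (x : ℕ → ℝ) : ℝ :=
  (∑ t ∈ Finset.range n, (x t - sampleMean n x) ^ 2) / ((n : ℝ) - d)

/-- The series standardized to have sample mean zero and sample variance one over its first `n`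
terms. -/
noncomputable def standardized (d n : ℕ) (x : ℕ → ℝ) (t : ℕ) : ℝ :=
  (x t - sampleMean n x) / √(sampleVar d n x)

/-- The statistic for volatility clustering with set of lags `T`, computed from the `n` observations
`x 0, …, x (n - 1)` after standardization. It is meant for `n` larger than every lag in `T`. -/
noncomputable def volatilityStat (d : ℕ) (T : Finset ℕ) (n : ℕ) (x : ℕ → ℝ) : ℝ :=
  n * ∑ τ ∈ T,
    ((∑ t ∈ Finset.range (n - τ),
        standardized d n x t ^ 2 * standardized d n x (t + τ) ^ 2) / ((n : ℝ) - τ) - 1) ^ 2 / 4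

/-- The chi-squared distribution with `k` degrees of freedom: the law of the sum of the squares of
`k` independent standard normal variables. -/
noncomputable def chiSquared (k : ℕ) : Measure ℝ :=
  (Measure.pi fun _ : Fin k => gaussianReal 0 1).map fun z => ∑ i, z i ^ 2

instance isProbabilityMeasure_chiSquared (k : ℕ) : IsProbabilityMeasure (chiSquared k) :=
  Measure.isProbabilityMeasure_map (Measurable.aemeasurable (by fun_prop))

/-!
For lags `τ ≥ 1`, write `y` for the series standardized by its true mean and variance and put
`w t = y t ^ 2 - 1`. The vector of lagged sums `n ^ (-1/2) * ∑ t < n, w t * w (t + τ)`, `τ ∈ T`, is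
asymptotically Gaussian by a central limit theorem for reverse martingale differences `D t` with
finite range dependence: revealing the summands from the last to the first, a Taylor expansion gives
a one-step recursion `φ_k ≈ (1 - σ² r² / 2) φ_{k+1}`, `r = n ^ (-1/2)`, for the characteristic
functions of the tails of the sum, because the linear term vanishes and `D k ^ 2` is independent of
all but boundedly many later summands.

The statistic does not change under affine maps of the series, and replacing `y` by its empirical
standardization moves the lagged moments of the squares by `o_P(n ^ (-1/2))` only: with `W` the
sample mean of `w`, up to `O_P(1/n)` the lagged moment of the squared deviations is `1 + 2 * W` plus
the mean of `w t * w (t + τ)`, the squared sample variance is `1 + 2 * W`, and `2 * W` cancels in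
their ratio. Hence the statistic is, up to `o_P(1)`, a quarter of the squared length of the Gaussian
vector, whose covariance is `(κ - 1) ^ 2` times the identity, `κ` being the kurtosis; for Gaussian
data `κ = 3`.
-/

section DependentCLT

lemma tendsto_inv_sqrt_natCast : Tendsto (fun n : ℕ => (√(n : ℝ))⁻¹) atTop (nhds 0) :=
  tendsto_inv_atTop_zero.comp (Real.tendsto_sqrt_atTop.comp tendsto_natCast_atTop_atTop)

lemma inv_sqrt_natCast_sq (n : ℕ) : (√(n : ℝ))⁻¹ ^ 2 = (n : ℝ)⁻¹ := by
  rw [inv_pow, Real.sq_sqrt n.cast_nonneg]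

open Complex in
lemma tendsto_one_sub_mul_inv_sqrt_sq_pow (c : ℝ) :
    Tendsto (fun n : ℕ => (((1 - c * (√n)⁻¹ ^ 2 / 2 : ℝ) ^ n : ℝ) : ℂ)) atTop
      (nhds (exp (-c / 2))) := by
  have h := (continuous_ofReal.tendsto _).comp (Real.tendsto_one_add_div_pow_exp (-c / 2))
  push_cast at h
  refine h.congr fun n => ?_
  simp only [Function.comp_apply, inv_sqrt_natCast_sq]
  congr 2
  ring

open Complex in
lemma norm_exp_ofReal_mul_I_sub_taylor_two_le (b : ℝ) :
    ‖exp (b * I) - (1 + b * I - (b : ℂ) ^ 2 / 2)‖ ≤ 4 * |b| ^ 3 := by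
  have hnorm : ‖(b : ℂ) * I‖ = |b| := by simp
  rcases le_or_gt |b| 1 with hb | hb
  · have hpoly : ∑ m ∈ Finset.range 3, ((b : ℂ) * I) ^ m / (m.factorial : ℂ)
        = 1 + b * I - (b : ℂ) ^ 2 / 2 := by
      simp only [Finset.sum_range_succ, Finset.sum_range_zero, mul_pow, I_sq, Nat.factorial]
      push_cast
      ring
    have h := exp_bound (hnorm.trans_le hb) (n := 3) (by norm_num)
    rw [hpoly, hnorm] at h
    refine h.trans ?_
    rw [mul_comm]
    gcongr
    norm_num [Nat.factorial]
  · have htaylor : ‖1 + b * I - (b : ℂ) ^ 2 / 2‖ ≤ 1 + |b| + |b| ^ 2 / 2 := by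
      refine (norm_sub_le _ _).trans (add_le_add ((norm_add_le _ _).trans ?_) ?_) <;> simp
    have h1 : |b| ≤ |b| ^ 3 := le_self_pow₀ hb.le (by norm_num)
    have h2 : |b| ^ 2 ≤ |b| ^ 3 := pow_le_pow_right₀ hb.le (by norm_num)
    calc _ ≤ ‖exp (b * I)‖ + ‖1 + b * I - (b : ℂ) ^ 2 / 2‖ := norm_sub_le _ _
      _ ≤ 1 + (1 + |b| + |b| ^ 2 / 2) := by rw [norm_exp_ofReal_mul_I]; gcongr
      _ ≤ _ := by linarith

open Complex in
lemma norm_exp_ofReal_mul_I_sub_le (a b : ℝ) : ‖exp (a * I) - exp (b * I)‖ ≤ |a - b| := by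
  have h : exp (a * I) - exp (b * I) = exp (b * I) * (exp (I * (a - b : ℝ)) - 1) := by
    rw [mul_sub, ← exp_add]
    push_cast
    ring_nf
  rw [h, norm_mul, norm_exp_ofReal_mul_I, one_mul, ← Real.norm_eq_abs]
  exact Real.norm_exp_I_mul_ofReal_sub_one_le

lemma norm_sub_pow_mul_le_of_recursion {A : ℕ → ℂ} {ρ : ℂ} {δ : ℝ} (hρ : ‖ρ‖ ≤ 1) {n : ℕ}
    (h : ∀ k < n, ‖A k - ρ * A (k + 1)‖ ≤ δ) : ‖A 0 - ρ ^ n * A n‖ ≤ n * δ := by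
  induction n with
  | zero => simp
  | succ n ih =>
    calc ‖A 0 - ρ ^ (n + 1) * A (n + 1)‖
        = ‖(A 0 - ρ ^ n * A n) + ρ ^ n * (A n - ρ * A (n + 1))‖ := by ring_nf
      _ ≤ n * δ + 1 * δ := by
        refine (norm_add_le _ _).trans (add_le_add (ih fun k hk => h k (by omega)) ?_)
        rw [norm_mul, norm_pow]
        gcongr
        · exact pow_le_one₀ (norm_nonneg _) hρ
        · exact h n n.lt_succ_self
      _ = _ := by push_cast; ring

variable {Ω : Type*} [MeasurableSpace Ω] {P : Measure Ω}

lemma integral_abs_pow_three_eq {X : Ω → ℝ} (hX : AEStronglyMeasurable X P) :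
    ∫ ω, |X ω| ^ 3 ∂P = lpNorm X 3 P ^ 3 := by
  have hrpow (a : ℝ) : ‖a‖ ^ (3 : ℝ) = |a| ^ 3 := by
    rw [Real.norm_eq_abs]; exact_mod_cast Real.rpow_natCast |a| 3
  rw [lpNorm_eq_integral_norm_rpow_toReal (by norm_num) (by norm_num) hX, ← Real.rpow_natCast,
    ENNReal.toReal_ofNat, Nat.cast_ofNat, Real.rpow_inv_rpow (by positivity) (by norm_num)]
  simp_rw [hrpow]

lemma memLp_sq_three_halves {X : Ω → ℝ} (hX : MemLp X 3 P) :
    MemLp (fun ω => X ω ^ 2) (ENNReal.ofReal (3 / 2)) P := by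
  have h := hX.norm_rpow_div 2
  rw [ENNReal.ofReal_div_of_pos two_pos, ENNReal.ofReal_ofNat, ENNReal.ofReal_ofNat]
  simpa using h

lemma integrable_abs_mul_sq {X Y : Ω → ℝ} (hX : MemLp X 3 P) (hY : MemLp Y 3 P) :
    Integrable (fun ω => |X ω| * Y ω ^ 2) P := by
  have : ENNReal.HolderTriple 3 (ENNReal.ofReal (3 / 2)) 1 := by
    refine ⟨?_⟩
    rw [inv_one, ← ENNReal.ofReal_inv_of_pos (by norm_num), ← ENNReal.ofReal_ofNat,
      ← ENNReal.ofReal_inv_of_pos (by norm_num), ← ENNReal.ofReal_add] <;> norm_num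
  exact memLp_one_iff_integrable.1 ((memLp_sq_three_halves hY).mul hX.abs)

lemma integral_abs_mul_sq_le {X Y : Ω → ℝ} (hX : MemLp X 3 P) (hY : MemLp Y 3 P) :
    ∫ ω, |X ω| * Y ω ^ 2 ∂P ≤ lpNorm X 3 P * lpNorm Y 3 P ^ 2 := by
  have hpq : (3 : ℝ).HolderConjugate (3 / 2) := ⟨by norm_num, by norm_num, by norm_num⟩
  have h := integral_mul_le_Lp_mul_Lq_of_nonneg hpq (ae_of_all P fun ω => abs_nonneg (X ω))
    (ae_of_all P fun ω => sq_nonneg (Y ω)) (by rw [ENNReal.ofReal_ofNat]; exact hX.abs)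
    (memLp_sq_three_halves hY)
  have hX3 (ω : Ω) : |X ω| ^ (3 : ℝ) = |X ω| ^ 3 := by exact_mod_cast Real.rpow_natCast |X ω| 3
  have hY3 (ω : Ω) : (Y ω ^ 2) ^ (3 / 2 : ℝ) = |Y ω| ^ 3 := by
    rw [← sq_abs, ← Real.rpow_natCast, ← Real.rpow_mul (abs_nonneg _)]
    norm_num
  simp_rw [hX3, hY3] at h
  rw [integral_abs_pow_three_eq hX.1, integral_abs_pow_three_eq hY.1, ← Real.rpow_natCast,
    ← Real.rpow_natCast, ← Real.rpow_mul lpNorm_nonneg, ← Real.rpow_mul lpNorm_nonneg] at h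
  norm_num at h
  exact h

open Complex in
lemma integrable_cexp_ofReal_mul_I [IsFiniteMeasure P] {S : Ω → ℝ} (hS : AEMeasurable S P) :
    Integrable (fun ω => exp (S ω * I)) P :=
  Integrable.of_bound (by fun_prop) 1 (ae_of_all _ fun _ => (norm_exp_ofReal_mul_I _).le)

open Complex in
lemma integrable_cexp_mul [IsFiniteMeasure P] {S : Ω → ℝ} {f : Ω → ℂ}
    (hS : AEMeasurable S P) (hf : Integrable f P) :
    Integrable (fun ω => exp (S ω * I) * f ω) P :=
  hf.bdd_mul (integrable_cexp_ofReal_mul_I hS).1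
    (ae_of_all _ fun _ => (norm_exp_ofReal_mul_I _).le)

lemma integrable_ofReal_sq [IsFiniteMeasure P] {D : Ω → ℝ} (hD : MemLp D 3 P) :
    Integrable (fun ω => (D ω : ℂ) ^ 2) P := by
  simpa using (hD.mono_exponent (p := 2) (by norm_num)).integrable_sq.ofReal (𝕜 := ℂ)

lemma sum_Ico_succ_sub_sum_Ico_le {E : Type*} [NormedAddCommGroup E] {p : ENNReal}
    {D : ℕ → Ω → E} {β : ℝ} (hp : 1 ≤ p) (hD : ∀ k, MemLp (D k) p P)
    (hβ : ∀ k, lpNorm (D k) p P ≤ β) (k M n : ℕ) :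
    MemLp (∑ j ∈ Finset.Ico (k + 1) n, D j - ∑ j ∈ Finset.Ico (k + M + 1) n, D j) p P ∧
      lpNorm (∑ j ∈ Finset.Ico (k + 1) n, D j - ∑ j ∈ Finset.Ico (k + M + 1) n, D j) p P
        ≤ M * β := by
  have hsub : Finset.Ico (k + M + 1) n ⊆ Finset.Ico (k + 1) n :=
    Finset.Ico_subset_Ico (by omega) le_rfl
  have hcard : (Finset.Ico (k + 1) n \ Finset.Ico (k + M + 1) n).card ≤ M := by
    rw [Finset.card_sdiff_of_subset hsub, Nat.card_Ico, Nat.card_Ico]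
    omega
  have hβ0 : 0 ≤ β := lpNorm_nonneg.trans (hβ 0)
  rw [← Finset.sum_sdiff hsub, add_sub_cancel_right]
  refine ⟨memLp_finsetSum' _ fun j _ => hD j, ?_⟩
  calc _ ≤ ∑ j ∈ Finset.Ico (k + 1) n \ Finset.Ico (k + M + 1) n, lpNorm (D j) p P :=
        lpNorm_sum_le (fun j _ => hD j) hp
    _ ≤ (Finset.Ico (k + 1) n \ Finset.Ico (k + M + 1) n).card • β :=
        Finset.sum_le_card_nsmul _ _ _ fun j _ => hβ j
    _ ≤ M * β := by
        rw [nsmul_eq_mul]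
        gcongr

variable [IsProbabilityMeasure P]

lemma integral_sq_le_lpNorm_three_sq {X : Ω → ℝ} (hX : MemLp X 3 P) :
    ∫ ω, X ω ^ 2 ∂P ≤ lpNorm X 3 P ^ 2 := by
  simpa using integral_abs_mul_sq_le (memLp_const (1 : ℝ)) hX

lemma integral_abs_le_lpNorm_three {X : Ω → ℝ} (hX : MemLp X 3 P) :
    ∫ ω, |X ω| ∂P ≤ lpNorm X 3 P := by
  simpa using integral_abs_mul_sq_le hX (memLp_const (1 : ℝ))

open Complex in
lemma norm_integral_cexp_add_sub_le {S D : Ω → ℝ} (hS : AEMeasurable S P) (hD : MemLp D 3 P)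
    (hmart : ∫ ω, exp (S ω * I) * D ω ∂P = 0) :
    ‖∫ ω, exp ((D ω + S ω : ℝ) * I) ∂P
      - (∫ ω, exp (S ω * I) ∂P - (∫ ω, exp (S ω * I) * D ω ^ 2 ∂P) / 2)‖
      ≤ 4 * lpNorm D 3 P ^ 3 := by
  have hDm : AEMeasurable D P := hD.1.aemeasurable
  have hexp := integrable_cexp_ofReal_mul_I hS
  have hD1 : Integrable (fun ω => exp (S ω * I) * D ω) P :=
    integrable_cexp_mul hS (hD.integrable (by norm_num)).ofReal
  have hD2 : Integrable (fun ω => exp (S ω * I) * D ω ^ 2) P :=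
    integrable_cexp_mul hS (integrable_ofReal_sq hD)
  have hlin : Integrable (fun ω => exp (S ω * I) + I * (exp (S ω * I) * D ω)) P :=
    hexp.add (hD1.const_mul I)
  have hquad : Integrable (fun ω => exp (S ω * I) + I * (exp (S ω * I) * D ω)
      - exp (S ω * I) * D ω ^ 2 / 2) P := hlin.sub (hD2.div_const 2)
  have hintegrand : ∫ ω, exp ((D ω + S ω : ℝ) * I) ∂P
      - (∫ ω, exp (S ω * I) ∂P - (∫ ω, exp (S ω * I) * D ω ^ 2 ∂P) / 2)
      = ∫ ω, exp (S ω * I) * (exp (D ω * I) - (1 + D ω * I - (D ω : ℂ) ^ 2 / 2)) ∂P := by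
    have hmart' : ∫ ω, I * (exp (S ω * I) * D ω) ∂P = 0 := by
      rw [integral_const_mul, hmart, mul_zero]
    rw [← integral_div, ← add_zero (∫ ω, exp (S ω * I) ∂P), ← hmart',
      ← integral_add hexp (hD1.const_mul I), ← integral_sub hlin (hD2.div_const 2),
      ← integral_sub (integrable_cexp_ofReal_mul_I (by fun_prop)) hquad]
    refine integral_congr_ae (ae_of_all _ fun ω => ?_)
    simp only [ofReal_add, add_mul, exp_add]
    ring
  rw [hintegrand, ← integral_abs_pow_three_eq hD.1, ← integral_const_mul]
  refine norm_integral_le_of_norm_le ((hD.integrable_norm_pow (by norm_num)).const_mul 4)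
    (ae_of_all _ fun ω => ?_)
  rw [norm_mul, norm_exp_ofReal_mul_I, one_mul]
  exact norm_exp_ofReal_mul_I_sub_taylor_two_le _

open Complex in
lemma norm_integral_cexp_mul_sq_sub_le {S S' D : Ω → ℝ} (hS : AEMeasurable S P)
    (hD : MemLp D 3 P) (hL : MemLp (S - S') 3 P) (hindep : IndepFun D S' P) :
    ‖∫ ω, exp (S ω * I) * D ω ^ 2 ∂P - (∫ ω, D ω ^ 2 ∂P : ℝ) * ∫ ω, exp (S ω * I) ∂P‖
      ≤ 2 * (lpNorm (S - S') 3 P * lpNorm D 3 P ^ 2) := by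
  have hS' : AEMeasurable S' P := by simpa using hS.sub hL.1.aemeasurable
  have hDm : AEMeasurable D P := hD.1.aemeasurable
  have hexp := integrable_cexp_ofReal_mul_I hS
  have hexp' := integrable_cexp_ofReal_mul_I hS'
  have hsq := integrable_cexp_mul hS (integrable_ofReal_sq hD)
  have hsq' := integrable_cexp_mul hS' (integrable_ofReal_sq hD)
  have hfactor : ∫ ω, exp (S' ω * I) * D ω ^ 2 ∂P
      = (∫ ω, D ω ^ 2 ∂P : ℝ) * ∫ ω, exp (S' ω * I) ∂P := by
    have h := hindep.symm.integral_comp_mul_comp (f := fun s : ℝ => exp (s * I))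
      (g := fun b : ℝ => (b : ℂ) ^ 2) hS' hDm (by fun_prop) (by fun_prop)
    rw [← integral_complex_ofReal, mul_comm]
    simpa using h
  have hlag (ω : Ω) : ‖exp (S ω * I) - exp (S' ω * I)‖ ≤ |(S - S') ω| :=
    norm_exp_ofReal_mul_I_sub_le _ _
  have h1 : ‖∫ ω, (exp (S ω * I) - exp (S' ω * I)) * D ω ^ 2 ∂P‖
      ≤ lpNorm (S - S') 3 P * lpNorm D 3 P ^ 2 := by
    refine (norm_integral_le_of_norm_le (integrable_abs_mul_sq hL hD)
      (ae_of_all _ fun ω => ?_)).trans (integral_abs_mul_sq_le hL hD)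
    simpa using mul_le_mul_of_nonneg_right (hlag ω) (sq_nonneg (D ω))
  have h2 : ‖∫ ω, (exp (S ω * I) - exp (S' ω * I)) ∂P‖ ≤ lpNorm (S - S') 3 P :=
    (norm_integral_le_of_norm_le (hL.integrable (by norm_num)).abs
      (ae_of_all _ hlag)).trans (integral_abs_le_lpNorm_three hL)
  have hdecomp : ∫ ω, exp (S ω * I) * D ω ^ 2 ∂P - (∫ ω, D ω ^ 2 ∂P : ℝ) * ∫ ω, exp (S ω * I) ∂P
      = ∫ ω, (exp (S ω * I) - exp (S' ω * I)) * D ω ^ 2 ∂P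
        - (∫ ω, D ω ^ 2 ∂P : ℝ) * ∫ ω, (exp (S ω * I) - exp (S' ω * I)) ∂P := by
    simp_rw [sub_mul]
    rw [integral_sub hsq hsq', integral_sub hexp hexp', hfactor]
    ring
  rw [hdecomp]
  refine (norm_sub_le _ _).trans ?_
  rw [norm_mul, norm_real, Real.norm_of_nonneg (integral_nonneg fun ω => sq_nonneg _), two_mul]
  refine add_le_add h1 ?_
  rw [mul_comm]
  gcongr
  · exact lpNorm_nonneg
  · exact integral_sq_le_lpNorm_three_sq hD

open Complex in
lemma norm_integral_cexp_add_sub_mul_le {S S' D : Ω → ℝ} (hS : AEMeasurable S P)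
    (hD : MemLp D 3 P) (hL : MemLp (S - S') 3 P) (hindep : IndepFun D S' P)
    (hmart : ∫ ω, exp (S ω * I) * D ω ∂P = 0) :
    ‖∫ ω, exp ((D ω + S ω : ℝ) * I) ∂P
      - (1 - (∫ ω, D ω ^ 2 ∂P) / 2 : ℝ) * ∫ ω, exp (S ω * I) ∂P‖
      ≤ 4 * lpNorm D 3 P ^ 3 + lpNorm (S - S') 3 P * lpNorm D 3 P ^ 2 := by
  have htaylor := norm_integral_cexp_add_sub_le hS hD hmart
  have hfreeze := norm_integral_cexp_mul_sq_sub_le hS hD hL hindep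
  set A := ∫ ω, exp ((D ω + S ω : ℝ) * I) ∂P
  set B := ∫ ω, exp (S ω * I) ∂P
  set Q := ∫ ω, exp (S ω * I) * D ω ^ 2 ∂P
  set v := ∫ ω, D ω ^ 2 ∂P
  calc ‖A - (1 - v / 2 : ℝ) * B‖ = ‖(A - (B - Q / 2)) - (Q - v * B) / 2‖ := by
        push_cast; ring_nf
    _ ≤ ‖A - (B - Q / 2)‖ + ‖Q - v * B‖ / 2 := by
        refine (norm_sub_le _ _).trans_eq ?_
        rw [norm_div, norm_ofNat]
    _ ≤ _ := by linarith

open Complex in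
lemma norm_integral_cexp_mul_add_sub_mul_le {S S' D : Ω → ℝ} (hS : AEMeasurable S P)
    (hD : MemLp D 3 P) (hL : MemLp (S - S') 3 P) (hindep : IndepFun D S' P) {r : ℝ} (hr : 0 ≤ r)
    (hmart : ∫ ω, exp ((r * S ω : ℝ) * I) * D ω ∂P = 0) :
    ‖∫ ω, exp ((r * (D ω + S ω) : ℝ) * I) ∂P
      - (1 - (∫ ω, D ω ^ 2 ∂P) * r ^ 2 / 2 : ℝ) * ∫ ω, exp ((r * S ω : ℝ) * I) ∂P‖
      ≤ (4 * lpNorm D 3 P ^ 3 + lpNorm (S - S') 3 P * lpNorm D 3 P ^ 2) * r ^ 3 := by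
  have hsub : r • S - r • S' = r • (S - S') := (smul_sub r S S').symm
  have hnorm (f : Ω → ℝ) : lpNorm (r • f) 3 P = r * lpNorm f 3 P := by
    rw [lpNorm_const_smul, coe_nnnorm, Real.norm_of_nonneg hr]
  have hmart' : ∫ ω, exp (((r • S) ω : ℝ) * I) * ((r • D) ω : ℝ) ∂P = 0 := by
    have h := congrArg ((r : ℂ) * ·) hmart
    simp only [mul_zero, ← integral_const_mul] at h
    rw [← h]
    refine integral_congr_ae (ae_of_all _ fun ω => ?_)
    simp only [Pi.smul_apply, smul_eq_mul, ofReal_mul]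
    ring
  have hvar : ∫ ω, (r • D) ω ^ 2 ∂P = (∫ ω, D ω ^ 2 ∂P) * r ^ 2 := by
    simp only [Pi.smul_apply, smul_eq_mul, mul_pow, integral_const_mul, mul_comm]
  have hstep := norm_integral_cexp_add_sub_mul_le (S' := r • S') (hS.const_smul r)
    (hD.const_smul r) (hsub ▸ hL.const_smul r)
    (hindep.comp (measurable_const_smul r) (measurable_const_smul r)) hmart'
  rw [hsub, hnorm, hnorm, hvar] at hstep
  simp only [Pi.smul_apply, smul_eq_mul, ← mul_add] at hstep
  convert! hstep using 1
  ring

variable {D : ℕ → Ω → ℝ} {M : ℕ} {β σ2 : ℝ}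

open Complex in
lemma norm_integral_cexp_sum_Ico_sub_le (hD : ∀ k, MemLp (D k) 3 P)
    (hβ : ∀ k, lpNorm (D k) 3 P ≤ β) (hσ : ∀ k, ∫ ω, D k ω ^ 2 ∂P = σ2)
    (hmart : ∀ k n (s : ℝ),
      ∫ ω, exp ((s * ∑ j ∈ Finset.Ico (k + 1) n, D j ω : ℝ) * I) * D k ω ∂P = 0)
    (hindep : ∀ k n, IndepFun (D k) (∑ j ∈ Finset.Ico (k + M + 1) n, D j) P)
    {r : ℝ} (hr : 0 ≤ r) {k n : ℕ} (hk : k < n) :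
    ‖∫ ω, exp ((r * ∑ j ∈ Finset.Ico k n, D j ω : ℝ) * I) ∂P
      - (1 - σ2 * r ^ 2 / 2 : ℝ) *
        ∫ ω, exp ((r * ∑ j ∈ Finset.Ico (k + 1) n, D j ω : ℝ) * I) ∂P‖
      ≤ (4 + M) * β ^ 3 * r ^ 3 := by
  obtain ⟨hL, hLβ⟩ := sum_Ico_succ_sub_sum_Ico_le (by norm_num) hD hβ k M n
  have hS : AEMeasurable (∑ j ∈ Finset.Ico (k + 1) n, D j) P :=
    Finset.aemeasurable_sum _ fun j _ => (hD j).1.aemeasurable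
  have hstep := norm_integral_cexp_mul_add_sub_mul_le hS (hD k) hL (hindep k n) hr
    (by simpa only [Finset.sum_apply] using hmart k n r)
  have hsucc (ω : Ω) : D k ω + ∑ j ∈ Finset.Ico (k + 1) n, D j ω = ∑ j ∈ Finset.Ico k n, D j ω :=
    (Finset.sum_eq_sum_Ico_succ_bot hk fun j => D j ω).symm
  simp only [hσ, Finset.sum_apply, hsucc] at hstep
  refine hstep.trans ?_
  gcongr
  calc _ ≤ 4 * β ^ 3 + M * β * β ^ 2 := by
        have hnonneg : 0 ≤ lpNorm (D k) 3 P := lpNorm_nonneg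
        have hβ0 : 0 ≤ β := hnonneg.trans (hβ k)
        have hβk := hβ k
        gcongr
    _ = (4 + M) * β ^ 3 := by ring

open Complex in
theorem tendsto_integral_cexp_inv_sqrt_mul_sum (hD : ∀ k, MemLp (D k) 3 P)
    (hβ : ∀ k, lpNorm (D k) 3 P ≤ β) (hσ : ∀ k, ∫ ω, D k ω ^ 2 ∂P = σ2)
    (hmart : ∀ k n (s : ℝ),
      ∫ ω, exp ((s * ∑ j ∈ Finset.Ico (k + 1) n, D j ω : ℝ) * I) * D k ω ∂P = 0)
    (hindep : ∀ k n, IndepFun (D k) (∑ j ∈ Finset.Ico (k + M + 1) n, D j) P) :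
    Tendsto (fun n : ℕ => ∫ ω, exp (((√n)⁻¹ * ∑ j ∈ Finset.range n, D j ω : ℝ) * I) ∂P) atTop
      (nhds (exp (-σ2 / 2))) := by
  have hσ0 : 0 ≤ σ2 := hσ 0 ▸ integral_nonneg fun ω => sq_nonneg _
  suffices hclose : Tendsto (fun n : ℕ =>
      ∫ ω, exp (((√n)⁻¹ * ∑ j ∈ Finset.range n, D j ω : ℝ) * I) ∂P
        - (((1 - σ2 * (√n)⁻¹ ^ 2 / 2 : ℝ) ^ n : ℝ) : ℂ)) atTop (nhds 0) by
    simpa using hclose.add (tendsto_one_sub_mul_inv_sqrt_sq_pow σ2)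
  have hbound : Tendsto (fun n : ℕ => (4 + M) * β ^ 3 * (√(n : ℝ))⁻¹) atTop (nhds 0) := by
    simpa using tendsto_inv_sqrt_natCast.const_mul ((4 + M) * β ^ 3)
  refine squeeze_zero_norm' ?_ hbound
  filter_upwards [eventually_ge_atTop ⌈σ2⌉₊, eventually_gt_atTop 0] with n hnσ hn
  have hn0 : (0 : ℝ) < n := by exact_mod_cast hn
  have hρ : ‖((1 - σ2 * (√(n : ℝ))⁻¹ ^ 2 / 2 : ℝ) : ℂ)‖ ≤ 1 := by
    have h1 : σ2 * (n : ℝ)⁻¹ ≤ 1 := by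
      rw [← div_eq_mul_inv]
      exact (div_le_one hn0).2 ((Nat.le_ceil σ2).trans (by exact_mod_cast hnσ))
    have h0 : 0 ≤ σ2 * (n : ℝ)⁻¹ := by positivity
    rw [norm_real, Real.norm_eq_abs, inv_sqrt_natCast_sq, abs_le]
    constructor <;> linarith
  have hrec := norm_sub_pow_mul_le_of_recursion
    (A := fun k => ∫ ω, exp (((√n)⁻¹ * ∑ j ∈ Finset.Ico k n, D j ω : ℝ) * I) ∂P) hρ fun k hk =>
    norm_integral_cexp_sum_Ico_sub_le hD hβ hσ hmart hindep
      (r := (√(n : ℝ))⁻¹) (by positivity) hk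
  simp only [Finset.Ico_self, Finset.sum_empty, mul_zero, ofReal_zero, zero_mul, exp_zero,
    integral_const, probReal_univ, one_smul, mul_one, Nat.Ico_zero_eq_range] at hrec
  rw [ofReal_pow]
  refine hrec.trans_eq ?_
  rw [pow_succ (√(n : ℝ))⁻¹ 2, inv_sqrt_natCast_sq]
  field_simp

end DependentCLT

section Independence

variable {Ω : Type*} [MeasurableSpace Ω] {P : Measure Ω}

lemma indepFun_of_dependsOn {ι E β γ : Type*} [Nonempty E] [MeasurableSpace E]
    [MeasurableSpace β] [MeasurableSpace γ] {y : ι → Ω → E} (hy : iIndepFun y P)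
    (hm : ∀ i, AEMeasurable (y i) P) {s t : Finset ι} (hst : Disjoint s t)
    {f : (ι → E) → β} {g : (ι → E) → γ} (hf : Measurable f) (hg : Measurable g)
    (hfs : DependsOn f (s : Set ι)) (hgt : DependsOn g (t : Set ι)) :
    IndepFun (fun ω => f fun i => y i ω) (fun ω => g fun i => y i ω) P := by
  classical
  let x₀ : ι → E := fun _ => Classical.arbitrary E
  have hf' : (fun ω => f fun i => y i ω)
      = (f ∘ Function.updateFinset x₀ s) ∘ fun ω (i : s) => y i ω := by
    ext ω
    exact hfs fun i hi => by simp [Function.updateFinset, Finset.mem_coe.1 hi]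
  have hg' : (fun ω => g fun i => y i ω)
      = (g ∘ Function.updateFinset x₀ t) ∘ fun ω (i : t) => y i ω := by
    ext ω
    exact hgt fun i hi => by simp [Function.updateFinset, Finset.mem_coe.1 hi]
  rw [hf', hg']
  exact (hy.indepFun_finset₀ s t hst hm).comp (hf.comp measurable_updateFinset)
    (hg.comp measurable_updateFinset)

variable {X Y : Ω → ℝ} {p : ENNReal}

lemma eLpNorm_mul_of_indepFun (h : IndepFun X Y P) (hX : AEMeasurable X P)
    (hY : AEMeasurable Y P) (hp : p ≠ 0) (hp' : p ≠ ⊤) :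
    eLpNorm (fun ω => X ω * Y ω) p P = eLpNorm X p P * eLpNorm Y p P := by
  have henorm : IndepFun (fun ω => ‖X ω‖ₑ ^ p.toReal) (fun ω => ‖Y ω‖ₑ ^ p.toReal) P :=
    h.comp (φ := fun x : ℝ => ‖x‖ₑ ^ p.toReal) (ψ := fun x : ℝ => ‖x‖ₑ ^ p.toReal)
      (by fun_prop) (by fun_prop)
  simp only [eLpNorm_eq_lintegral_rpow_enorm_toReal hp hp', enorm_mul,
    ENNReal.mul_rpow_of_nonneg _ _ ENNReal.toReal_nonneg]
  rw [lintegral_mul_eq_lintegral_mul_lintegral_of_indepFun'' (by fun_prop) (by fun_prop) henorm,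
    ENNReal.mul_rpow_of_nonneg _ _ (by positivity)]

lemma memLp_mul_of_indepFun (h : IndepFun X Y P) (hX : MemLp X p P) (hY : MemLp Y p P)
    (hp : p ≠ 0) (hp' : p ≠ ⊤) : MemLp (fun ω => X ω * Y ω) p P := by
  refine ⟨hX.1.mul hY.1, ?_⟩
  rw [eLpNorm_mul_of_indepFun h hX.aemeasurable hY.aemeasurable hp hp']
  exact ENNReal.mul_lt_top hX.2 hY.2

lemma memLp_comp_of_hasLaw {E F : Type*} [MeasurableSpace E] [NormedAddCommGroup F] {ν : Measure E}
    {Z : Ω → E} (hZ : HasLaw Z ν P) {f : E → F} (hf : MemLp f p ν) :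
    MemLp (fun ω => f (Z ω)) p P :=
  MemLp.comp_of_map (by rwa [hZ.map_eq]) hZ.aemeasurable

lemma lpNorm_comp_of_hasLaw {E F : Type*} [MeasurableSpace E] [NormedAddCommGroup F] {ν : Measure E}
    {Z : Ω → E} (hZ : HasLaw Z ν P) {f : E → F} (hf : AEStronglyMeasurable f ν) :
    lpNorm (fun ω => f (Z ω)) p P = lpNorm f p ν := by
  have hf' : AEStronglyMeasurable f (P.map Z) := by rwa [hZ.map_eq]
  rw [← toReal_eLpNorm (f := fun ω => f (Z ω)) (hf'.comp_aemeasurable hZ.aemeasurable),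
    ← toReal_eLpNorm hf, ← hZ.map_eq, eLpNorm_map_measure hf' hZ.aemeasurable]
  rfl

end Independence

section LaggedProducts

variable {ι : Type*} {τ : ι → ℕ}

/-- The normalized sums `n ^ (-1/2) * ∑ t < n, x t * x (t + τ i)` of lagged products, as a vector
indexed by the lags. -/
noncomputable def laggedVector (τ : ι → ℕ) (n : ℕ) (x : ℕ → ℝ) : EuclideanSpace ℝ ι :=
  WithLp.toLp 2 fun i => (√(n : ℝ))⁻¹ * ∑ t ∈ Finset.range n, x t * x (t + τ i)

@[fun_prop]
lemma measurable_laggedVector (n : ℕ) : Measurable (laggedVector τ n) := by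
  unfold laggedVector
  fun_prop

variable [Fintype ι]

/-- The summand at time `t` of a linear combination, with coefficients `θ`, of the sums of lagged
products `x t * x (t + τ i)`; by the Cramér–Wold device these sums are jointly asymptotically normal
as soon as all their linear combinations are. -/
noncomputable def laggedProduct (τ : ι → ℕ) (θ : ι → ℝ) (t : ℕ) (x : ℕ → ℝ) : ℝ :=
  x t * ∑ i, θ i * x (t + τ i)

variable {θ : ι → ℝ}

@[fun_prop]
lemma measurable_laggedProduct (t : ℕ) : Measurable (laggedProduct τ θ t) := by
  unfold laggedProduct
  fun_prop

lemma laggedProduct_eq_shift (t : ℕ) (x : ℕ → ℝ) :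
    laggedProduct τ θ t x = laggedProduct τ θ 0 fun j => x (t + j) := by
  simp [laggedProduct]

lemma dependsOn_laggedProduct {M : ℕ} (hτM : ∀ i, τ i ≤ M) (t : ℕ) :
    DependsOn (laggedProduct τ θ t) (Finset.Icc t (t + M) : Set ℕ) := by
  intro x x' h
  have hτ (i) : x (t + τ i) = x' (t + τ i) := h _ (by simp [hτM i])
  simp only [laggedProduct, h t (by simp), hτ]

lemma dependsOn_sum_laggedProduct {M : ℕ} (hτM : ∀ i, τ i ≤ M) (k n : ℕ) :
    DependsOn (fun x => ∑ t ∈ Finset.Ico k n, laggedProduct τ θ t x)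
      (Finset.Ico k (n + M) : Set ℕ) := by
  intro x x' h
  refine Finset.sum_congr rfl fun t ht => dependsOn_laggedProduct hτM t fun j hj => h j ?_
  simp only [Finset.coe_Icc, Set.mem_Icc, Finset.mem_Ico, Finset.coe_Ico, Set.mem_Ico] at *
  omega

variable {Ω : Type*} [MeasurableSpace Ω] {P : Measure Ω}
  {ξ : ℕ → Ω → ℝ} {ν : Measure ℝ}

lemma memLp_sum_mul {p : ENNReal} (hlaw : ∀ t, HasLaw (ξ t) ν P) (hν : MemLp id p ν) (t : ℕ) :
    MemLp (fun ω => ∑ i, θ i * ξ (t + τ i) ω) p P :=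
  memLp_finsetSum _ fun i _ => (memLp_comp_of_hasLaw (hlaw _) hν).const_mul (θ i)

lemma indepFun_sum_mul (hξ : iIndepFun ξ P) (hlaw : ∀ t, HasLaw (ξ t) ν P) (hτ : ∀ i, 1 ≤ τ i)
    (t : ℕ) : IndepFun (ξ t) (fun ω => ∑ i, θ i * ξ (t + τ i) ω) P := by
  refine indepFun_of_dependsOn hξ (fun t => (hlaw t).aemeasurable) (s := {t})
    (t := Finset.univ.image fun i => t + τ i) (f := fun x : ℕ → ℝ => x t)
    (g := fun x : ℕ → ℝ => ∑ i, θ i * x (t + τ i)) ?_ (by fun_prop) (by fun_prop) ?_ ?_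
  · simp only [Finset.disjoint_singleton_left, Finset.mem_image, not_exists]
    rintro i ⟨-, h⟩
    have := hτ i
    omega
  · exact fun x x' h => h t (by simp)
  · exact fun x x' h => Finset.sum_congr rfl fun i _ => by rw [h (t + τ i) (by simp)]

lemma memLp_laggedProduct {p : ENNReal} (hp : p ≠ 0) (hp' : p ≠ ⊤) (hξ : iIndepFun ξ P)
    (hlaw : ∀ t, HasLaw (ξ t) ν P) (hν : MemLp id p ν) (hτ : ∀ i, 1 ≤ τ i) (t : ℕ) :
    MemLp (fun ω => laggedProduct τ θ t fun j => ξ j ω) p P :=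
  memLp_mul_of_indepFun (indepFun_sum_mul hξ hlaw hτ t) (memLp_comp_of_hasLaw (hlaw t) hν)
    (memLp_sum_mul hlaw hν t) hp hp'

lemma lpNorm_laggedProduct_eq (p : ENNReal) (hξ : iIndepFun ξ P)
    (hlaw : ∀ t, HasLaw (ξ t) ν P) (t : ℕ) :
    lpNorm (fun ω => laggedProduct τ θ t fun j => ξ j ω) p P
      = lpNorm (fun ω => laggedProduct τ θ 0 fun j => ξ j ω) p P := by
  have hP := hξ.isProbabilityMeasure
  have : IsProbabilityMeasure ν := (hlaw 0).isProbabilityMeasure_iff.1 hP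
  have hm (s : ℕ) : AEMeasurable (ξ s) P := (hlaw s).aemeasurable
  have hshift : HasLaw (fun ω j => ξ (t + j) ω) (Measure.infinitePi fun _ => ν) P :=
    (hξ.precomp (add_right_injective t)).hasLaw_infinitePi (fun j => hlaw (t + j)) (by fun_prop)
  have hmeas := (measurable_laggedProduct (τ := τ) (θ := θ) 0).aestronglyMeasurable
    (μ := Measure.infinitePi fun _ => ν)
  simp_rw [laggedProduct_eq_shift t]
  rw [lpNorm_comp_of_hasLaw hshift hmeas,
    lpNorm_comp_of_hasLaw (hξ.hasLaw_infinitePi hlaw (by fun_prop)) hmeas]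

lemma integral_sum_mul_sq (hξ : iIndepFun ξ P) (hlaw : ∀ t, HasLaw (ξ t) ν P)
    (hν : MemLp id 2 ν) (hν0 : ∫ x, x ∂ν = 0) (hτ : Function.Injective τ) (t : ℕ) :
    ∫ ω, (∑ i, θ i * ξ (t + τ i) ω) ^ 2 ∂P = (∫ x, x ^ 2 ∂ν) * ∑ i, θ i ^ 2 := by
  have hP := hξ.isProbabilityMeasure
  have hm (s : ℕ) : AEMeasurable (ξ s) P := (hlaw s).aemeasurable
  have hξ0 (s : ℕ) : ∫ ω, ξ s ω ∂P = 0 := by rw [(hlaw s).integral_eq, hν0]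
  have hξ2 (s : ℕ) : MemLp (ξ s) 2 P := memLp_comp_of_hasLaw (hlaw s) hν
  have hvar (s : ℕ) : Var[ξ s; P] = ∫ x, x ^ 2 ∂ν := by
    rw [(hlaw s).variance_eq, variance_of_integral_eq_zero (by fun_prop) (by simpa using hν0)]
    rfl
  have hmean : ∫ ω, ∑ i, θ i * ξ (t + τ i) ω ∂P = 0 := by
    rw [integral_finsetSum _ fun i _ => ((hξ2 _).integrable one_le_two).const_mul _]
    simp [integral_const_mul, hξ0]
  have hsum := IndepFun.variance_sum (μ := P) (s := Finset.univ)
    (X := fun i ω => θ i * ξ (t + τ i) ω) (fun i _ => (hξ2 _).const_mul _) fun i _ j _ hij =>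
    (hξ.indepFun ((add_right_injective t).comp hτ |>.ne hij)).comp
      (measurable_const_mul (θ i)) (measurable_const_mul (θ j))
  rw [← variance_of_integral_eq_zero (by fun_prop) hmean, ← Finset.sum_fn, hsum, Finset.mul_sum]
  simp_rw [variance_const_mul, hvar, mul_comm]

lemma integral_laggedProduct_sq (hξ : iIndepFun ξ P) (hlaw : ∀ t, HasLaw (ξ t) ν P)
    (hν : MemLp id 2 ν) (hν0 : ∫ x, x ∂ν = 0) (hτ : ∀ i, 1 ≤ τ i) (hτi : Function.Injective τ)
    (t : ℕ) :
    ∫ ω, (laggedProduct τ θ t fun j => ξ j ω) ^ 2 ∂P = (∫ x, x ^ 2 ∂ν) ^ 2 * ∑ i, θ i ^ 2 := by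
  have hm (s : ℕ) : AEMeasurable (ξ s) P := (hlaw s).aemeasurable
  simp only [laggedProduct, mul_pow]
  have hsq : ∫ ω, ξ t ω ^ 2 ∂P = ∫ x, x ^ 2 ∂ν :=
    (hlaw t).integral_comp (f := fun x : ℝ => x ^ 2) (by fun_prop)
  rw [(indepFun_sum_mul hξ hlaw hτ t).integral_fun_comp_mul_comp (f := fun x : ℝ => x ^ 2)
      (g := fun x : ℝ => x ^ 2) (hm t) (by fun_prop) (by fun_prop) (by fun_prop),
    integral_sum_mul_sq hξ hlaw hν hν0 hτi t, hsq]
  ring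

lemma indepFun_laggedProduct_sum (hξ : iIndepFun ξ P) (hlaw : ∀ t, HasLaw (ξ t) ν P) {M : ℕ}
    (hτM : ∀ i, τ i ≤ M) (k n : ℕ) :
    IndepFun (fun ω => laggedProduct τ θ k fun j => ξ j ω)
      (fun ω => ∑ t ∈ Finset.Ico (k + M + 1) n, laggedProduct τ θ t fun j => ξ j ω) P := by
  refine indepFun_of_dependsOn hξ (fun t => (hlaw t).aemeasurable) ?_ (by fun_prop) (by fun_prop)
    (dependsOn_laggedProduct hτM k) (dependsOn_sum_laggedProduct hτM (k + M + 1) n)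
  refine Finset.disjoint_left.2 fun j hj hj' => ?_
  simp only [Finset.mem_Icc, Finset.mem_Ico] at hj hj'
  omega

open Complex in
lemma integral_cexp_sum_mul_laggedProduct (hξ : iIndepFun ξ P) (hlaw : ∀ t, HasLaw (ξ t) ν P)
    (hν0 : ∫ x, x ∂ν = 0) (hτ : ∀ i, 1 ≤ τ i) (k n : ℕ) (s : ℝ) :
    ∫ ω, exp ((s * ∑ t ∈ Finset.Ico (k + 1) n, laggedProduct τ θ t fun j => ξ j ω : ℝ) * I)
      * (laggedProduct τ θ k fun j => ξ j ω) ∂P = 0 := by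
  have hm (t : ℕ) : AEMeasurable (ξ t) P := (hlaw t).aemeasurable
  set M := Finset.univ.sup τ
  have hτM (i) : τ i ≤ M := Finset.le_sup (Finset.mem_univ i)
  let G (x : ℕ → ℝ) : ℂ :=
    exp ((s * ∑ t ∈ Finset.Ico (k + 1) n, laggedProduct τ θ t x : ℝ) * I)
      * ((∑ i, θ i * x (k + τ i) : ℝ) : ℂ)
  have hG : Measurable G := by fun_prop
  have hGdep : DependsOn G (Finset.Ico (k + 1) (k + 1 + n + M) : Set ℕ) := by
    intro x x' h
    have hsum := dependsOn_sum_laggedProduct (θ := θ) hτM (k + 1) n (x := x) (y := x')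
      fun j hj => h j (by simp only [Finset.coe_Ico, Set.mem_Ico] at *; omega)
    have hlin (i) : x (k + τ i) = x' (k + τ i) := h _ (by
      have := hτ i; have := hτM i; simp only [Finset.coe_Ico, Set.mem_Ico]; omega)
    simp only [G, hlin]
    simp only at hsum
    rw [hsum]
  have hind : IndepFun (fun ω => (ξ k ω : ℂ)) (fun ω => G fun j => ξ j ω) P :=
    indepFun_of_dependsOn hξ hm (s := {k}) (f := fun x : ℕ → ℝ => (x k : ℂ)) (by simp)
      (by fun_prop) hG (fun x x' h => by simp only [h k (by simp)]) hGdep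
  calc _ = ∫ ω, (ξ k ω : ℂ) * G (fun j => ξ j ω) ∂P := by
        refine integral_congr_ae (ae_of_all _ fun ω => ?_)
        simp only [G, laggedProduct]
        push_cast
        ring
    _ = 0 := by
        rw [hind.integral_fun_mul_eq_mul_integral (by fun_prop)
          (hG.comp_aemeasurable (by fun_prop)).aestronglyMeasurable, integral_complex_ofReal,
          (hlaw k).integral_eq, hν0, ofReal_zero, zero_mul]

lemma inner_laggedVector (θ : EuclideanSpace ℝ ι) (n : ℕ) (x : ℕ → ℝ) :
    inner ℝ (laggedVector τ n x) θ
      = (√(n : ℝ))⁻¹ * ∑ t ∈ Finset.range n, laggedProduct τ θ t x := by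
  simp only [laggedVector, PiLp.inner_apply, RCLike.inner_apply, conj_trivial, laggedProduct,
    Finset.mul_sum]
  rw [Finset.sum_comm]
  exact Finset.sum_congr rfl fun t _ => Finset.sum_congr rfl fun i _ => by ring

theorem tendstoInDistribution_laggedVector [IsProbabilityMeasure P] (hξ : iIndepFun ξ P)
    (hlaw : ∀ t, HasLaw (ξ t) ν P) (hν : MemLp id 3 ν) (hν0 : ∫ x, x ∂ν = 0) (hτ : ∀ i, 1 ≤ τ i)
    (hτi : Function.Injective τ) :
    TendstoInDistribution (fun n ω => laggedVector τ n fun t => ξ t ω) atTop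
      (fun z => (∫ x, x ^ 2 ∂ν) • z) (fun _ => P) (stdGaussian (EuclideanSpace ℝ ι)) := by
  have hm (t : ℕ) : AEMeasurable (ξ t) P := (hlaw t).aemeasurable
  have hmn (n : ℕ) : AEMeasurable (fun ω => laggedVector τ n fun t => ξ t ω) P := by fun_prop
  have hν' : IsProbabilityMeasure ν := (hlaw 0).isProbabilityMeasure_iff.1 inferInstance
  refine ⟨hmn, by fun_prop, ProbabilityMeasure.tendsto_iff_tendsto_charFun.2 fun θ => ?_⟩
  simp only [ProbabilityMeasure.coe_mk, charFun_map_smul, charFun_stdGaussian]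
  have hclt := tendsto_integral_cexp_inv_sqrt_mul_sum
    (D := fun k ω => laggedProduct τ θ k fun j => ξ j ω) (M := Finset.univ.sup τ)
    (memLp_laggedProduct (by simp) (by simp) hξ hlaw hν hτ)
    (fun k => (lpNorm_laggedProduct_eq 3 hξ hlaw k).le)
    (integral_laggedProduct_sq hξ hlaw (hν.mono_exponent (by norm_num)) hν0 hτ hτi)
    (integral_cexp_sum_mul_laggedProduct hξ hlaw hν0 hτ) fun k n => by
      simpa only [Finset.sum_fn] using
        indepFun_laggedProduct_sum hξ hlaw (fun i => Finset.le_sup (Finset.mem_univ i)) k n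
  convert! hclt using 2
  · rw [charFun_apply, integral_map (hmn _) (by fun_prop)]
    simp_rw [inner_laggedVector]
  · rw [norm_smul, ← Complex.ofReal_pow, mul_pow, EuclideanSpace.real_norm_sq_eq,
      Real.norm_eq_abs, sq_abs]

end LaggedProducts

section StochasticOrder

variable {Ω ι : Type*} [MeasurableSpace Ω]

/-- The stochastic Landau symbol `X = O_P(c)` along the filter `l`: up to an event of small
probability, `X i` is bounded by a constant multiple of the deterministic rate `c i`. -/
def IsBigOInProb (P : Measure Ω) (l : Filter ι) (X : ι → Ω → ℝ) (c : ι → ℝ) : Prop :=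
  ∀ δ : ENNReal, 0 < δ → ∃ K : ℝ, 0 ≤ K ∧ ∀ᶠ i in l, P {ω | K * |c i| < |X i ω|} ≤ δ

variable {P : Measure Ω} {l : Filter ι} {X Y : ι → Ω → ℝ} {b c : ι → ℝ}

lemma measure_le_of_le_half_of_subset_union {s t u : Set Ω} {δ : ENNReal} (hs : P s ≤ δ / 2)
    (ht : P t ≤ δ / 2) (hu : u ⊆ s ∪ t) : P u ≤ δ :=
  calc P u ≤ P (s ∪ t) := measure_mono hu
    _ ≤ P s + P t := measure_union_le s t
    _ ≤ δ / 2 + δ / 2 := add_le_add hs ht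
    _ = δ := ENNReal.add_halves δ

namespace IsBigOInProb

lemma add (hX : IsBigOInProb P l X c) (hY : IsBigOInProb P l Y c) :
    IsBigOInProb P l (fun i ω => X i ω + Y i ω) c := by
  intro δ hδ
  obtain ⟨K, hK, hXK⟩ := hX (δ / 2) (ENNReal.half_pos hδ.ne')
  obtain ⟨L, hL, hYL⟩ := hY (δ / 2) (ENNReal.half_pos hδ.ne')
  refine ⟨K + L, add_nonneg hK hL, ?_⟩
  filter_upwards [hXK, hYL] with i hXi hYi
  refine measure_le_of_le_half_of_subset_union hXi hYi fun ω hω => ?_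
  by_contra hn
  simp only [Set.mem_union, Set.mem_ofPred_eq, not_or, not_lt, add_mul] at hn hω
  linarith [abs_add_le (X i ω) (Y i ω)]

lemma mul (hX : IsBigOInProb P l X b) (hY : IsBigOInProb P l Y c) :
    IsBigOInProb P l (fun i ω => X i ω * Y i ω) fun i => b i * c i := by
  intro δ hδ
  obtain ⟨K, hK, hXK⟩ := hX (δ / 2) (ENNReal.half_pos hδ.ne')
  obtain ⟨L, hL, hYL⟩ := hY (δ / 2) (ENNReal.half_pos hδ.ne')
  refine ⟨K * L, mul_nonneg hK hL, ?_⟩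
  filter_upwards [hXK, hYL] with i hXi hYi
  refine measure_le_of_le_half_of_subset_union hXi hYi fun ω hω => ?_
  by_contra hn
  simp only [Set.mem_union, Set.mem_ofPred_eq, not_or, not_lt, abs_mul] at hn hω
  refine hω.not_ge ((mul_le_mul hn.1 hn.2 (abs_nonneg _) (by positivity)).trans_eq ?_)
  ring

lemma of_abs_le {x : ι → ℝ} (h : ∀ᶠ i in l, |x i| ≤ |c i|) :
    IsBigOInProb P l (fun i _ => x i) c := by
  refine fun δ _ => ⟨1, zero_le_one, ?_⟩
  filter_upwards [h] with i hi
  simp [hi.not_gt]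

lemma one_mul (hX : IsBigOInProb P l X 1) (hY : IsBigOInProb P l Y c) :
    IsBigOInProb P l (fun i ω => X i ω * Y i ω) c := by
  simpa only [Pi.one_apply, _root_.one_mul] using hX.mul hY

lemma const_one (a : ℝ) : IsBigOInProb P l (fun _ _ => a) 1 := by
  refine fun δ _ => ⟨|a|, abs_nonneg a, Eventually.of_forall fun i => ?_⟩
  simp

lemma const_mul (a : ℝ) (hX : IsBigOInProb P l X c) :
    IsBigOInProb P l (fun i ω => a * X i ω) c :=
  (const_one a).one_mul hX

lemma sub (hX : IsBigOInProb P l X c) (hY : IsBigOInProb P l Y c) :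
    IsBigOInProb P l (fun i ω => X i ω - Y i ω) c := by
  simpa only [neg_one_mul, ← sub_eq_add_neg] using hX.add (hY.const_mul (-1))

lemma trans_abs_le (hX : IsBigOInProb P l X b) (h : ∀ᶠ i in l, |b i| ≤ |c i|) :
    IsBigOInProb P l X c := by
  intro δ hδ
  obtain ⟨K, hK, hXK⟩ := hX δ hδ
  refine ⟨K, hK, ?_⟩
  filter_upwards [hXK, h] with i hXi hi
  exact (measure_mono fun ω hω => (mul_le_mul_of_nonneg_left hi hK).trans_lt hω).trans hXi

lemma of_integral_sq_le [IsFiniteMeasure P] {C : ℝ} (hX : ∀ i, MemLp (X i) 2 P)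
    (hC : ∀ i, ∫ ω, X i ω ^ 2 ∂P ≤ C * c i ^ 2) : IsBigOInProb P l X c := by
  intro δ hδ
  obtain ⟨ε, hε, hεδ⟩ := ENNReal.lt_iff_exists_nnreal_btwn.1 hδ
  have hε' : (0 : ℝ) < ε := by exact_mod_cast hε
  set K : ℝ := √((|C| + 1) / ε) with hK
  have hK2 : C ≤ ε * K ^ 2 := by
    rw [hK, Real.sq_sqrt (by positivity), mul_div_cancel₀ _ hε'.ne']
    exact (le_abs_self C).trans (lt_add_one _).le
  refine ⟨K, by positivity, Eventually.of_forall fun i => le_trans ?_ hεδ.le⟩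
  have hnonneg : 0 ≤ᵐ[P] fun ω => X i ω ^ 2 := ae_of_all _ fun ω => sq_nonneg _
  rcases eq_or_ne (c i) 0 with hc | hc
  · have hzero : ∫ ω, X i ω ^ 2 ∂P = 0 :=
      le_antisymm (by simpa [hc] using hC i) (integral_nonneg_of_ae hnonneg)
    rw [integral_eq_zero_iff_of_nonneg_ae hnonneg (hX i).integrable_sq] at hzero
    refine (measure_mono_null (fun ω hω => ?_) hzero).trans_le zero_le
    simpa [hc] using hω
  · have hpos : 0 < (K * |c i|) ^ 2 := by positivity
    have markov := mul_meas_ge_le_integral_of_nonneg hnonneg (hX i).integrable_sq ((K * |c i|) ^ 2)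
    have hreal : P.real {ω | (K * |c i|) ^ 2 ≤ X i ω ^ 2} ≤ ε := by
      refine le_of_mul_le_mul_left ((markov.trans (hC i)).trans ?_) hpos
      rw [mul_pow, sq_abs]
      nlinarith [sq_nonneg (c i)]
    refine le_trans (measure_mono fun ω hω => ?_) ((ENNReal.le_ofReal_iff_toReal_le
      (measure_ne_top _ _) ε.coe_nonneg).2 hreal |>.trans_eq ENNReal.ofReal_coe_nnreal)
    have hω' : K * |c i| < |X i ω| := hω
    exact (pow_le_pow_left₀ (by positivity) hω'.le 2).trans_eq (sq_abs _)

lemma tendstoInMeasure_zero (hX : IsBigOInProb P l X c) (hc : Tendsto c l (nhds 0)) :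
    TendstoInMeasure P X l 0 := by
  simp only [tendstoInMeasure_iff_norm, Pi.zero_apply, sub_zero, Real.norm_eq_abs,
    ENNReal.tendsto_nhds_zero]
  intro ε hε δ hδ
  obtain ⟨K, -, hXK⟩ := hX δ hδ
  have hKc : Tendsto (fun i => K * |c i|) l (nhds 0) := by simpa using hc.abs.const_mul K
  filter_upwards [hXK, hKc.eventually_lt_const hε] with i hXi hi
  exact (measure_mono fun ω hω => hi.trans_le hω).trans hXi

lemma congr' (hX : IsBigOInProb P l X c) (h : ∀ᶠ i in l, ∀ ω, X i ω = Y i ω) :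
    IsBigOInProb P l Y c := by
  intro δ hδ
  obtain ⟨K, hK, hXK⟩ := hX δ hδ
  refine ⟨K, hK, ?_⟩
  filter_upwards [hXK, h] with i hXi hi
  simpa only [hi] using hXi

lemma inv_mul (hX : IsBigOInProb P l X fun i => (c i)⁻¹) (hY : IsBigOInProb P l Y c) :
    IsBigOInProb P l (fun i ω => X i ω * Y i ω) 1 := by
  refine (hX.mul hY).trans_abs_le (.of_forall fun i => ?_)
  simpa only [abs_mul, abs_inv, Pi.one_apply, abs_one] using inv_mul_le_one

lemma of_tendsto_zero (hX : IsBigOInProb P l X c) (hc : Tendsto c l (nhds 0)) :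
    IsBigOInProb P l X 1 := by
  have hle : ∀ᶠ i in l, |c i| ≤ 1 := hc.abs.eventually_le_const (by simp)
  exact hX.trans_abs_le (by simpa using hle)

end IsBigOInProb

lemma isBigOInProb_one_of_tendstoInMeasure {a : ℝ} (hX : TendstoInMeasure P X l fun _ => a) :
    IsBigOInProb P l X 1 := by
  simp only [tendstoInMeasure_iff_norm, Real.norm_eq_abs, ENNReal.tendsto_nhds_zero] at hX
  refine fun δ hδ => ⟨|a| + 1, by positivity, (hX 1 one_pos δ hδ).mono fun i hi => ?_⟩
  refine (measure_mono fun ω hω => ?_).trans hi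
  simp only [Pi.one_apply, abs_one, mul_one, Set.mem_ofPred_eq] at hω ⊢
  linarith [abs_sub_abs_le_abs_sub (X i ω) a]

lemma tendstoInMeasure_of_tendsto {x : ι → ℝ} {a : ℝ} (h : Tendsto x l (nhds a)) :
    TendstoInMeasure P (fun i _ => x i) l fun _ => a := by
  simp only [tendstoInMeasure_iff_norm, Real.norm_eq_abs]
  intro ε hε
  refine tendsto_const_nhds.congr' ?_
  filter_upwards [Metric.tendsto_nhds.1 h ε hε] with i hi
  rw [Real.dist_eq] at hi
  simp [hi.not_ge]

lemma tendstoInMeasure_zero_mul (hX : TendstoInMeasure P X l 0) (hY : IsBigOInProb P l Y 1) :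
    TendstoInMeasure P (fun i ω => X i ω * Y i ω) l 0 := by
  simp only [tendstoInMeasure_iff_norm, Pi.zero_apply, sub_zero, Real.norm_eq_abs,
    ENNReal.tendsto_nhds_zero] at hX ⊢
  intro ε hε δ hδ
  obtain ⟨K, hK, hYK⟩ := hY (δ / 2) (ENNReal.half_pos hδ.ne')
  filter_upwards [hX (ε / (K + 1)) (by positivity) (δ / 2) (ENNReal.half_pos hδ.ne'), hYK]
    with i hXi hYi
  refine measure_le_of_le_half_of_subset_union hXi hYi fun ω hω => ?_
  by_contra hn
  simp only [Set.mem_union, Set.mem_ofPred_eq, not_or, not_lt, not_le, Pi.one_apply, abs_one,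
    mul_one, abs_mul] at hn hω
  have hlt := mul_lt_mul'' hn.1 (hn.2.trans_lt (lt_add_one K)) (abs_nonneg _) (abs_nonneg _)
  rw [div_mul_cancel₀ _ (by positivity)] at hlt
  exact hω.not_gt hlt

lemma tendstoInMeasure_zero_add (hX : TendstoInMeasure P X l 0) (hY : TendstoInMeasure P Y l 0) :
    TendstoInMeasure P (fun i ω => X i ω + Y i ω) l 0 := by
  simp only [tendstoInMeasure_iff_norm, Pi.zero_apply, sub_zero, Real.norm_eq_abs,
    ENNReal.tendsto_nhds_zero] at hX hY ⊢
  intro ε hε δ hδ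
  filter_upwards [hX (ε / 2) (half_pos hε) (δ / 2) (ENNReal.half_pos hδ.ne'),
    hY (ε / 2) (half_pos hε) (δ / 2) (ENNReal.half_pos hδ.ne')] with i hXi hYi
  refine measure_le_of_le_half_of_subset_union hXi hYi fun ω hω => ?_
  by_contra hn
  simp only [Set.mem_union, Set.mem_ofPred_eq, not_or, not_le] at hn hω
  linarith [abs_add_le (X i ω) (Y i ω)]

lemma tendstoInMeasure_zero_sum {κ : Type*} {s : Finset κ} {Z : κ → ι → Ω → ℝ}
    (h : ∀ j ∈ s, TendstoInMeasure P (Z j) l 0) :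
    TendstoInMeasure P (fun i ω => ∑ j ∈ s, Z j i ω) l 0 := by
  classical
  induction s using Finset.induction_on with
  | empty => exact tendstoInMeasure_of_tendsto tendsto_const_nhds
  | insert j s hj ih =>
    simp only [Finset.sum_insert hj]
    exact tendstoInMeasure_zero_add (h j (by simp)) (ih fun k hk => h k (by simp [hk]))

lemma tendstoInMeasure_comp_of_continuousAt {a : ℝ} {g : ℝ → ℝ} (hg : ContinuousAt g a)
    (hX : TendstoInMeasure P X l fun _ => a) :
    TendstoInMeasure P (fun i ω => g (X i ω)) l fun _ => g a := by
  simp only [tendstoInMeasure_iff_dist] at hX ⊢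
  intro ε hε
  obtain ⟨η, hη, h⟩ := Metric.continuousAt_iff.1 hg ε hε
  refine tendsto_of_tendsto_of_tendsto_of_le_of_le tendsto_const_nhds (hX η hη)
    (fun _ => zero_le) fun i => measure_mono fun ω hω => ?_
  exact le_of_not_gt fun hlt => (h hlt).not_ge hω

lemma tendstoInMeasure_zero_of_eqOn {a : ℝ} {s : Set ℝ} (hs : s ∈ nhds a)
    (hX : TendstoInMeasure P X l fun _ => a) (h : ∀ i ω, X i ω ∈ s → Y i ω = 0) :
    TendstoInMeasure P Y l 0 := by
  obtain ⟨η, hη, hball⟩ := Metric.mem_nhds_iff.1 hs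
  simp only [tendstoInMeasure_iff_dist] at hX ⊢
  intro ε hε
  refine tendsto_of_tendsto_of_tendsto_of_le_of_le tendsto_const_nhds (hX η hη)
    (fun _ => zero_le) fun i => measure_mono fun ω hω => ?_
  by_contra hle
  have hlt : dist (X i ω) a < η := not_le.1 hle
  have hY : Y i ω = 0 := h i ω (hball hlt)
  simp only [Set.mem_ofPred_eq, hY, Pi.zero_apply, dist_self] at hω
  exact hω.not_gt hε

end StochasticOrder

section OrthogonalSums

variable {Ω : Type*} [MeasurableSpace Ω] {P : Measure Ω} {ξ : ℕ → Ω → ℝ} {C : ℝ}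

/-- A sequence of pairwise orthogonal random variables in `L²` whose second moments are bounded
by `C`. Sums of such variables are of the order of the square root of the number of terms. -/
structure IsOrthogonalBounded (P : Measure Ω) (ξ : ℕ → Ω → ℝ) (C : ℝ) : Prop where
  memLp : ∀ t, MemLp (ξ t) 2 P
  integral_sq_le : ∀ t, ∫ ω, ξ t ω ^ 2 ∂P ≤ C
  integral_mul : ∀ s t, s < t → ∫ ω, ξ s ω * ξ t ω ∂P = 0

namespace IsOrthogonalBounded

lemma nonneg (h : IsOrthogonalBounded P ξ C) : 0 ≤ C :=
  (integral_nonneg fun _ => sq_nonneg _).trans (h.integral_sq_le 0)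

lemma integral_sum_sq_le (h : IsOrthogonalBounded P ξ C) (I : Finset ℕ) :
    ∫ ω, (∑ t ∈ I, ξ t ω) ^ 2 ∂P ≤ I.card * C := by
  have hint (s t : ℕ) : Integrable (fun ω => ξ s ω * ξ t ω) P :=
    (h.memLp s).integrable_mul (h.memLp t)
  simp only [sq, Finset.sum_mul_sum]
  rw [integral_finsetSum _ fun s _ => integrable_finsetSum _ fun t _ => hint s t, ← nsmul_eq_mul]
  refine Finset.sum_le_card_nsmul _ _ _ fun s hs => ?_
  rw [integral_finsetSum _ fun t _ => hint s t, Finset.sum_eq_single_of_mem s hs]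
  · simpa only [sq] using h.integral_sq_le s
  · intro t _ hts
    rcases lt_or_gt_of_ne hts with hlt | hlt
    · simpa only [mul_comm] using h.integral_mul t s hlt
    · exact h.integral_mul s t hlt

lemma isBigOInProb_sum {ι : Type*} {l : Filter ι} [IsFiniteMeasure P]
    (h : IsOrthogonalBounded P ξ C) {I : ι → Finset ℕ} {c : ι → ℝ} {K : ℝ}
    (hI : ∀ i, ((I i).card : ℝ) ≤ K * c i ^ 2) :
    IsBigOInProb P l (fun i ω => ∑ t ∈ I i, ξ t ω) c := by
  refine .of_integral_sq_le (C := K * C) (fun i => memLp_finsetSum _ fun t _ => h.memLp t)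
    fun i => (h.integral_sum_sq_le _).trans ?_
  rw [mul_right_comm]
  exact mul_le_mul_of_nonneg_right (hI i) h.nonneg

end IsOrthogonalBounded

variable {y : ℕ → Ω → ℝ} {μ : Measure ℝ} {f g : ℝ → ℝ}

lemma isOrthogonalBounded_comp (hy : iIndepFun y P) (hlaw : ∀ t, HasLaw (y t) μ P)
    (hf : Measurable f) (hf2 : MemLp f 2 μ) (hf0 : ∫ x, f x ∂μ = 0) :
    IsOrthogonalBounded P (fun t ω => f (y t ω)) (∫ x, f x ^ 2 ∂μ) where
  memLp t := memLp_comp_of_hasLaw (hlaw t) hf2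
  integral_sq_le t :=
    ((hlaw t).integral_comp (f := fun x => f x ^ 2) (by fun_prop)).le
  integral_mul s t hst := by
    have hind : IndepFun (fun ω => f (y s ω)) (fun ω => f (y t ω)) P :=
      (hy.indepFun hst.ne).comp hf hf
    have hzero : ∫ ω, f (y t ω) ∂P = 0 := ((hlaw t).integral_comp hf2.1).trans hf0
    rw [hind.integral_fun_mul_eq_mul_integral (memLp_comp_of_hasLaw (hlaw s) hf2).1
      (memLp_comp_of_hasLaw (hlaw t) hf2).1, hzero, mul_zero]

lemma isOrthogonalBounded_comp_mul_comp (hy : iIndepFun y P) (hlaw : ∀ t, HasLaw (y t) μ P)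
    (hf : Measurable f) (hg : Measurable g) (hf2 : MemLp f 2 μ) (hg2 : MemLp g 2 μ)
    (hg0 : ∫ x, g x ∂μ = 0) {τ : ℕ} (hτ : 1 ≤ τ) :
    IsOrthogonalBounded P (fun t ω => f (y t ω) * g (y (t + τ) ω))
      ((∫ x, f x ^ 2 ∂μ) * ∫ x, g x ^ 2 ∂μ) where
  memLp t := memLp_mul_of_indepFun ((hy.indepFun (by omega)).comp hf hg)
    (memLp_comp_of_hasLaw (hlaw t) hf2) (memLp_comp_of_hasLaw (hlaw (t + τ)) hg2)
    (by simp) (by simp)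
  integral_sq_le t := by
    have hind : IndepFun (fun ω => f (y t ω) ^ 2) (fun ω => g (y (t + τ) ω) ^ 2) P :=
      (hy.indepFun (i := t) (j := t + τ) (by omega)).comp (hf.pow_const 2) (hg.pow_const 2)
    simp_rw [mul_pow]
    rw [hind.integral_fun_mul_eq_mul_integral
      ((memLp_comp_of_hasLaw (hlaw t) hf2).1.pow 2)
      ((memLp_comp_of_hasLaw (hlaw (t + τ)) hg2).1.pow 2),
      ← (hlaw t).integral_comp (f := fun x => f x ^ 2) (by fun_prop),
      ← (hlaw (t + τ)).integral_comp (f := fun x => g x ^ 2) (by fun_prop)]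
    rfl
  integral_mul s t hst := by
    have hmemf (t : ℕ) := (memLp_comp_of_hasLaw (hlaw t) hf2).1
    have hmemg (t : ℕ) := (memLp_comp_of_hasLaw (hlaw t) hg2).1
    have hzero : ∫ ω, g (y (t + τ) ω) ∂P = 0 := ((hlaw (t + τ)).integral_comp hg2.1).trans hg0
    have hind : IndepFun (fun ω => f (y s ω) * g (y (s + τ) ω) * f (y t ω))
        (fun ω => g (y (t + τ) ω)) P := by
      refine indepFun_of_dependsOn hy (fun t => (hlaw t).aemeasurable)
        (s := Finset.range (t + τ)) (t := {t + τ})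
        (f := fun w : ℕ → ℝ => f (w s) * g (w (s + τ)) * f (w t))
        (g := fun w : ℕ → ℝ => g (w (t + τ))) (by simp) (by fun_prop) (by fun_prop) ?_ ?_
      · intro v w h
        simp only [Finset.coe_range, Set.mem_Iio] at h ⊢
        rw [h s (by omega), h (s + τ) (by omega), h t (by omega)]
      · intro v w h
        simp only [h (t + τ) (by simp)]
    simp_rw [← mul_assoc]
    rw [hind.integral_fun_mul_eq_mul_integral (((hmemf s).mul (hmemg _)).mul (hmemf t)) (hmemg _),
      hzero, mul_zero]

end OrthogonalSums

section LagSums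

/-- The lagged sum `∑ t < N, f t * g (t + τ)`, an unnormalized sample cross-moment at lag `τ`. -/
noncomputable def lagSum (τ N : ℕ) (f g : ℕ → ℝ) : ℝ :=
  ∑ t ∈ Finset.range N, f t * g (t + τ)

variable {τ n : ℕ} {f : ℕ → ℝ}

lemma lagSum_sub_mul_sub (τ N : ℕ) (u y : ℕ → ℝ) (p q : ℝ) :
    lagSum τ N (fun t => u t - p * y t - q) (fun t => u t - p * y t - q)
      = lagSum τ N u u - p * (lagSum τ N u y + lagSum τ N y u) + p ^ 2 * lagSum τ N y y
        - q * (∑ t ∈ Finset.range N, u t + ∑ t ∈ Finset.range N, u (t + τ))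
        + p * q * (∑ t ∈ Finset.range N, y t + ∑ t ∈ Finset.range N, y (t + τ)) + N * q ^ 2 := by
  simp only [lagSum]
  induction N with
  | zero => simp
  | succ N ih =>
    simp only [Finset.sum_range_succ, ih]
    push_cast
    ring

lemma lagSum_add_const (τ N : ℕ) (f : ℕ → ℝ) (c : ℝ) :
    lagSum τ N (fun t => f t + c) (fun t => f t + c) = lagSum τ N f f
      + c * (∑ t ∈ Finset.range N, f t + ∑ t ∈ Finset.range N, f (t + τ)) + N * c ^ 2 := by
  simpa using lagSum_sub_mul_sub τ N f 0 0 (-c)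

lemma sum_range_shift_eq_sum_Ico (f : ℕ → ℝ) (τ N : ℕ) :
    ∑ t ∈ Finset.range N, f (t + τ) = ∑ t ∈ Finset.Ico τ (N + τ), f t := by
  rw [Finset.sum_Ico_eq_sum_range, Nat.add_sub_cancel]
  simp only [add_comm]

lemma sum_range_add_sum_range_shift_of_sum_eq_zero (hτ : τ ≤ n)
    (hf : ∑ t ∈ Finset.range n, f t = 0) :
    ∑ t ∈ Finset.range (n - τ), f t + ∑ t ∈ Finset.range (n - τ), f (t + τ)
      = -(∑ t ∈ Finset.Ico (n - τ) n, f t + ∑ t ∈ Finset.range τ, f t) := by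
  rw [sum_range_shift_eq_sum_Ico, Nat.sub_add_cancel hτ]
  linarith [Finset.sum_range_add_sum_Ico f (Nat.sub_le n τ), Finset.sum_range_add_sum_Ico f hτ]

end LagSums

section AffineInvariance

lemma sampleMean_sub_div {n : ℕ} (hn : n ≠ 0) (a s : ℝ) (x : ℕ → ℝ) :
    (sampleMean n fun t => (x t - a) / s) = (sampleMean n x - a) / s := by
  simp only [sampleMean, ← Finset.sum_div, Finset.sum_sub_distrib, Finset.sum_const,
    Finset.card_range, nsmul_eq_mul]
  field_simp

lemma sampleVar_sub_div {n : ℕ} (hn : n ≠ 0) (d : ℕ) (a s : ℝ) (x : ℕ → ℝ) :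
    (sampleVar d n fun t => (x t - a) / s) = sampleVar d n x / s ^ 2 := by
  simp only [sampleVar, sampleMean_sub_div hn, ← sub_div, sub_sub_sub_cancel_right, div_pow,
    ← Finset.sum_div]
  exact div_right_comm _ _ _

lemma standardized_sub_div {n : ℕ} (hn : n ≠ 0) (d : ℕ) (a : ℝ) {s : ℝ} (hs : 0 < s)
    (x : ℕ → ℝ) : (standardized d n fun t => (x t - a) / s) = standardized d n x := by
  ext t
  rw [standardized, standardized, sampleMean_sub_div hn, sampleVar_sub_div hn,
    Real.sqrt_div' _ (sq_nonneg s), Real.sqrt_sq hs.le, ← sub_div, sub_sub_sub_cancel_right,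
    div_div_div_cancel_right₀ hs.ne']

lemma volatilityStat_sub_div (d : ℕ) (T : Finset ℕ) (n : ℕ) (a : ℝ) {s : ℝ} (hs : 0 < s)
    (x : ℕ → ℝ) : (volatilityStat d T n fun t => (x t - a) / s) = volatilityStat d T n x := by
  rcases eq_or_ne n 0 with rfl | hn
  · simp [volatilityStat]
  · simp only [volatilityStat, standardized_sub_div hn d a hs x]

end AffineInvariance

section SampleMoments

variable {d n : ℕ}

lemma sampleMean_sub_const (hn : n ≠ 0) (x : ℕ → ℝ) (c : ℝ) :
    sampleMean n (fun t => x t - c) = sampleMean n x - c := by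
  simpa only [div_one] using sampleMean_sub_div hn c 1 x

lemma sampleVar_zero_eq_sampleMean (n : ℕ) (x : ℕ → ℝ) :
    sampleVar 0 n x = sampleMean n fun t => (x t - sampleMean n x) ^ 2 := by
  simp [sampleVar, sampleMean]

lemma sampleVar_zero_eq_sub_sq (hn : n ≠ 0) (x : ℕ → ℝ) :
    sampleVar 0 n x = sampleMean n (fun t => x t ^ 2) - sampleMean n x ^ 2 := by
  have hn' : (n : ℝ) ≠ 0 := by exact_mod_cast hn
  have hsum : ∑ t ∈ Finset.range n, x t = n * sampleMean n x := by
    rw [sampleMean, mul_div_cancel₀ _ hn']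
  have hexpand : ∑ t ∈ Finset.range n, (x t - sampleMean n x) ^ 2
      = ∑ t ∈ Finset.range n, x t ^ 2 - n * sampleMean n x ^ 2 := by
    simp only [sub_sq, Finset.sum_add_distrib, Finset.sum_sub_distrib, ← Finset.sum_mul,
      ← Finset.mul_sum, hsum, Finset.sum_const, Finset.card_range, nsmul_eq_mul]
    ring
  rw [sampleVar, hexpand, Nat.cast_zero, sub_zero, sub_div, mul_div_cancel_left₀ _ hn',
    ← sampleMean]

lemma sampleVar_eq_sampleVar_zero_mul (hn : n ≠ 0) (x : ℕ → ℝ) :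
    sampleVar d n x = sampleVar 0 n x * (n / ((n : ℝ) - d)) := by
  have hn' : (n : ℝ) ≠ 0 := by exact_mod_cast hn
  rw [sampleVar, sampleVar, Nat.cast_zero, sub_zero, div_mul_div_cancel₀ hn']

lemma standardized_sq (hd : d ≤ n) (x : ℕ → ℝ) (t : ℕ) :
    standardized d n x t ^ 2 = (x t - sampleMean n x) ^ 2 / sampleVar d n x := by
  have hnonneg : 0 ≤ sampleVar d n x :=
    div_nonneg (Finset.sum_nonneg fun _ _ => sq_nonneg _) (sub_nonneg.2 (by exact_mod_cast hd))
  rw [standardized, div_pow, Real.sq_sqrt hnonneg]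

lemma measurable_volatilityStat (d : ℕ) (T : Finset ℕ) (n : ℕ) :
    Measurable (volatilityStat d T n) := by
  unfold volatilityStat standardized sampleVar sampleMean
  fun_prop

lemma sum_sub_sampleMean (hn : n ≠ 0) (x : ℕ → ℝ) :
    ∑ t ∈ Finset.range n, (x t - sampleMean n x) = 0 := by
  have hn' : (n : ℝ) ≠ 0 := by exact_mod_cast hn
  rw [Finset.sum_sub_distrib, Finset.sum_const, Finset.card_range, nsmul_eq_mul, sampleMean,
    mul_div_cancel₀ _ hn', sub_self]

lemma lagSum_self_eq_lagSum_sub_sampleMean {τ : ℕ} (hτ : τ ≤ n) (hn : n ≠ 0) (x : ℕ → ℝ) :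
    lagSum τ (n - τ) x x
      = lagSum τ (n - τ) (fun t => x t - sampleMean n x) (fun t => x t - sampleMean n x)
        - sampleMean n x * (∑ t ∈ Finset.Ico (n - τ) n, (x t - sampleMean n x)
          + ∑ t ∈ Finset.range τ, (x t - sampleMean n x))
        + (n - τ : ℕ) * sampleMean n x ^ 2 := by
  have h := lagSum_add_const τ (n - τ) (fun t => x t - sampleMean n x) (sampleMean n x)
  rw [sum_range_add_sum_range_shift_of_sum_eq_zero hτ (sum_sub_sampleMean hn x)] at h
  simp only [sub_add_cancel] at h
  rw [h]
  ring

end SampleMoments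

section StandardizedIID

variable {Ω : Type*} [MeasurableSpace Ω] {P : Measure Ω} {y : ℕ → Ω → ℝ} {μ : Measure ℝ}

/-- The squared deviations from the sample mean of the first `n` terms. -/
noncomputable def sqDev (n : ℕ) (x : ℕ → ℝ) (t : ℕ) : ℝ := (x t - sampleMean n x) ^ 2

lemma memLp_sq_sub_one_of_memLp_id [IsFiniteMeasure μ] {p : ENNReal} (hμ : MemLp id (2 * p) μ) :
    MemLp (fun x => x ^ 2 - 1) p μ := by
  have : ENNReal.HolderTriple (2 * p) (2 * p) p := ⟨by
    rw [ENNReal.mul_inv (by simp) (by simp), ← add_mul, ENNReal.inv_two_add_inv_two, one_mul]⟩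
  have hsq : MemLp (fun x : ℝ => x ^ 2) p μ := by
    simpa only [sq, Pi.mul_def, id] using hμ.mul hμ
  exact hsq.sub (memLp_const 1)

/-- An independent sequence of random variables with common law `μ` of mean zero, variance one and
finite fourth moment. -/
structure IsStandardizedIID (P : Measure Ω) (y : ℕ → Ω → ℝ) (μ : Measure ℝ) : Prop where
  iIndepFun : iIndepFun y P
  hasLaw : ∀ t, HasLaw (y t) μ P
  memLp : MemLp id 4 μ
  integral_id : ∫ x, x ∂μ = 0
  integral_sq : ∫ x, x ^ 2 ∂μ = 1

lemma isBigOInProb_sqrt_sum [IsFiniteMeasure P] {ξ : ℕ → Ω → ℝ} {C : ℝ}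
    (h : IsOrthogonalBounded P ξ C) {I : ℕ → Finset ℕ} (hI : ∀ n, (I n).card ≤ n) :
    IsBigOInProb P atTop (fun n ω => ∑ t ∈ I n, ξ t ω) fun n => √n :=
  h.isBigOInProb_sum (K := 1) fun n => by
    rw [one_mul, Real.sq_sqrt (Nat.cast_nonneg n)]
    exact_mod_cast hI n

lemma isBigOInProb_one_sum [IsFiniteMeasure P] {ξ : ℕ → Ω → ℝ} {C : ℝ}
    (h : IsOrthogonalBounded P ξ C) {I : ℕ → Finset ℕ} {K : ℕ} (hI : ∀ n, (I n).card ≤ K) :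
    IsBigOInProb P atTop (fun n ω => ∑ t ∈ I n, ξ t ω) 1 :=
  h.isBigOInProb_sum (K := K) fun n => by simpa using hI n

lemma isBigOInProb_sqrt_sum_add_sum_shift [IsFiniteMeasure P] {ξ : ℕ → Ω → ℝ} {C : ℝ}
    (h : IsOrthogonalBounded P ξ C) (τ : ℕ) :
    IsBigOInProb P atTop (fun n ω => ∑ t ∈ Finset.range (n - τ), ξ t ω
      + ∑ t ∈ Finset.range (n - τ), ξ (t + τ) ω) fun n => √n := by
  have hshift := isBigOInProb_sqrt_sum h (I := fun n => Finset.Ico τ (n - τ + τ))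
    fun n => by simp
  refine (isBigOInProb_sqrt_sum h (I := fun n => Finset.range (n - τ)) fun n => by simp).add
    (hshift.congr' (.of_forall fun n ω => ?_))
  exact (sum_range_shift_eq_sum_Ico (fun t => ξ t ω) τ (n - τ)).symm

lemma isBigOInProb_sampleMean [IsFiniteMeasure P] {ξ : ℕ → Ω → ℝ} {C : ℝ}
    (h : IsOrthogonalBounded P ξ C) :
    IsBigOInProb P atTop (fun n ω => sampleMean n fun t => ξ t ω) fun n => (√n)⁻¹ := by
  have hinv : IsBigOInProb P atTop (fun (n : ℕ) _ => (n : ℝ)⁻¹) fun n => (n : ℝ)⁻¹ :=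
    .of_abs_le (.of_forall fun _ => le_rfl)
  have hsum := isBigOInProb_sqrt_sum h (I := Finset.range) fun n => (Finset.card_range n).le
  simp only [sampleMean, div_eq_inv_mul]
  refine (hinv.mul hsum).trans_abs_le (.of_forall fun n => le_of_eq ?_)
  rw [← div_eq_inv_mul, Real.sqrt_div_self', one_div]

namespace IsStandardizedIID

lemma isFiniteMeasure (h : IsStandardizedIID P y μ) : IsFiniteMeasure P :=
  have := h.iIndepFun.isProbabilityMeasure
  inferInstance

lemma isProbabilityMeasure_law (h : IsStandardizedIID P y μ) : IsProbabilityMeasure μ :=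
  have := h.iIndepFun.isProbabilityMeasure
  (h.hasLaw 0).map_eq ▸ Measure.isProbabilityMeasure_map (h.hasLaw 0).aemeasurable

lemma memLp_id_two (h : IsStandardizedIID P y μ) : MemLp (fun x => x) 2 μ :=
  have := h.isProbabilityMeasure_law
  h.memLp.mono_exponent (by norm_num)

lemma memLp_sq_sub_one (h : IsStandardizedIID P y μ) : MemLp (fun x => x ^ 2 - 1) 2 μ := by
  have := h.isProbabilityMeasure_law
  exact memLp_sq_sub_one_of_memLp_id (p := 2) (by norm_num; exact h.memLp)

lemma integral_sq_sub_one (h : IsStandardizedIID P y μ) : ∫ x, (x ^ 2 - 1) ∂μ = 0 := by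
  have := h.isProbabilityMeasure_law
  rw [integral_sub h.memLp_id_two.integrable_sq (integrable_const 1), h.integral_sq]
  simp

lemma isOrthogonalBounded_self (h : IsStandardizedIID P y μ) :
    IsOrthogonalBounded P y (∫ x, x ^ 2 ∂μ) :=
  isOrthogonalBounded_comp h.iIndepFun h.hasLaw measurable_id h.memLp_id_two h.integral_id

lemma isOrthogonalBounded_sq_sub_one (h : IsStandardizedIID P y μ) :
    IsOrthogonalBounded P (fun t ω => y t ω ^ 2 - 1) (∫ x, (x ^ 2 - 1) ^ 2 ∂μ) :=
  isOrthogonalBounded_comp h.iIndepFun h.hasLaw (by fun_prop) h.memLp_sq_sub_one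
    h.integral_sq_sub_one

lemma isBigOInProb_lagSum (h : IsStandardizedIID P y μ) {f g : ℝ → ℝ} (hf : Measurable f)
    (hg : Measurable g) (hf2 : MemLp f 2 μ) (hg2 : MemLp g 2 μ) (hg0 : ∫ x, g x ∂μ = 0) {τ : ℕ}
    (hτ : 1 ≤ τ) {N : ℕ → ℕ} (hN : ∀ n, N n ≤ n) :
    IsBigOInProb P atTop (fun n ω => lagSum τ (N n) (fun t => f (y t ω)) fun t => g (y t ω))
      fun n => √n :=
  have := h.isFiniteMeasure
  isBigOInProb_sqrt_sum
    (isOrthogonalBounded_comp_mul_comp h.iIndepFun h.hasLaw hf hg hf2 hg2 hg0 hτ)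
    (I := fun n => Finset.range (N n)) (by simpa using hN)

lemma isBigOInProb_lagSum_sub_mul_sub (h : IsStandardizedIID P y μ) {τ : ℕ} (hτ : 1 ≤ τ)
    {p q : ℕ → Ω → ℝ} (hp : IsBigOInProb P atTop p fun n => (√n)⁻¹)
    (hq : IsBigOInProb P atTop q fun n => (√n)⁻¹) :
    IsBigOInProb P atTop (fun n ω =>
      lagSum τ (n - τ) (fun t => y t ω ^ 2 - 1 - p n ω * y t ω - q n ω)
        (fun t => y t ω ^ 2 - 1 - p n ω * y t ω - q n ω)
      - lagSum τ (n - τ) (fun t => y t ω ^ 2 - 1) (fun t => y t ω ^ 2 - 1)) 1 := by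
  have := h.isFiniteMeasure
  have hN (n : ℕ) : n - τ ≤ n := Nat.sub_le n τ
  have hy := h.isOrthogonalBounded_self
  have hu := h.isOrthogonalBounded_sq_sub_one
  have huy := h.isBigOInProb_lagSum (f := fun x => x ^ 2 - 1) (g := fun x => x) (by fun_prop)
    (by fun_prop) h.memLp_sq_sub_one h.memLp_id_two h.integral_id hτ hN
  have hyu := h.isBigOInProb_lagSum (f := fun x => x) (g := fun x => x ^ 2 - 1) (by fun_prop)
    (by fun_prop) h.memLp_id_two h.memLp_sq_sub_one h.integral_sq_sub_one hτ hN
  have hyy := h.isBigOInProb_lagSum (f := fun x => x) (g := fun x => x) (by fun_prop)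
    (by fun_prop) h.memLp_id_two h.memLp_id_two h.integral_id hτ hN
  have hNn : IsBigOInProb P atTop (fun n _ => ((n - τ : ℕ) : ℝ)) fun n => (n : ℝ) :=
    .of_abs_le (.of_forall fun n => by simp)
  have hqN : IsBigOInProb P atTop (fun n ω => q n ω * ((n - τ : ℕ) : ℝ)) fun n => √n :=
    (hq.mul hNn).trans_abs_le (.of_forall fun n => by
      rw [← div_eq_inv_mul, Real.div_sqrt])
  have hp1 := hp.of_tendsto_zero tendsto_inv_sqrt_natCast
  have hbound := ((((hp1.one_mul (hp.inv_mul hyy)).sub (hp.inv_mul (huy.add hyu))).sub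
    (hq.inv_mul (isBigOInProb_sqrt_sum_add_sum_shift hu τ))).add
    (hp1.one_mul (hq.inv_mul (isBigOInProb_sqrt_sum_add_sum_shift hy τ)))).add (hq.inv_mul hqN)
  refine hbound.congr' (.of_forall fun n ω => ?_)
  rw [lagSum_sub_mul_sub]
  ring

end IsStandardizedIID

end StandardizedIID

section SampleMomentExpansion

variable {Ω : Type*} [MeasurableSpace Ω] {P : Measure Ω} {y : ℕ → Ω → ℝ} {μ : Measure ℝ}

lemma sqDev_sub_sampleVar {n : ℕ} (hn : n ≠ 0) (x : ℕ → ℝ) (t : ℕ) :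
    sqDev n x t - sampleVar 0 n x = x t ^ 2 - 1 - 2 * sampleMean n x * x t
      - (sampleMean n (fun s => x s ^ 2 - 1) - 2 * sampleMean n x ^ 2) := by
  rw [sqDev, sampleVar_zero_eq_sub_sq hn, sampleMean_sub_const hn]
  ring

namespace IsStandardizedIID

lemma isBigOInProb_one_sum_sub_mul_sub (h : IsStandardizedIID P y μ) {p q : ℕ → Ω → ℝ}
    (hp : IsBigOInProb P atTop p 1) (hq : IsBigOInProb P atTop q 1) {I : ℕ → Finset ℕ} {K : ℕ}
    (hI : ∀ n, (I n).card ≤ K) :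
    IsBigOInProb P atTop
      (fun n ω => ∑ t ∈ I n, (y t ω ^ 2 - 1 - p n ω * y t ω - q n ω)) 1 := by
  have := h.isFiniteMeasure
  have hcard : IsBigOInProb P atTop (fun n _ => ((I n).card : ℝ)) 1 :=
    fun _ _ => ⟨K, K.cast_nonneg, .of_forall fun n => by simp [(hI n).not_gt]⟩
  refine (((isBigOInProb_one_sum h.isOrthogonalBounded_sq_sub_one hI).sub
    (hp.one_mul (isBigOInProb_one_sum h.isOrthogonalBounded_self hI))).sub
    (hcard.one_mul hq)).congr' (.of_forall fun n ω => ?_)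
  simp only [Finset.sum_sub_distrib, ← Finset.mul_sum, Finset.sum_const, nsmul_eq_mul]

lemma isBigOInProb_sampleMean (h : IsStandardizedIID P y μ) :
    IsBigOInProb P atTop (fun n ω => sampleMean n fun t => y t ω) fun n => (√n)⁻¹ :=
  have := h.isFiniteMeasure
  _root_.isBigOInProb_sampleMean h.isOrthogonalBounded_self

lemma isBigOInProb_sampleMean_sq (h : IsStandardizedIID P y μ) :
    IsBigOInProb P atTop (fun n ω => sampleMean n (fun t => y t ω) ^ 2) fun n => (√n)⁻¹ := by
  simpa only [sq] using
    (h.isBigOInProb_sampleMean.of_tendsto_zero tendsto_inv_sqrt_natCast).one_mul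
      h.isBigOInProb_sampleMean

lemma isBigOInProb_sampleMean_sq_sub_one (h : IsStandardizedIID P y μ) :
    IsBigOInProb P atTop (fun n ω => sampleMean n fun t => y t ω ^ 2 - 1) fun n => (√n)⁻¹ :=
  have := h.isFiniteMeasure
  _root_.isBigOInProb_sampleMean h.isOrthogonalBounded_sq_sub_one

lemma isBigOInProb_sampleVar_sub_one (h : IsStandardizedIID P y μ) :
    IsBigOInProb P atTop (fun n ω => sampleVar 0 n (fun t => y t ω) - 1) fun n => (√n)⁻¹ := by
  refine (h.isBigOInProb_sampleMean_sq_sub_one.sub h.isBigOInProb_sampleMean_sq).congr' ?_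
  filter_upwards [eventually_ne_atTop 0] with n hn ω
  rw [sampleVar_zero_eq_sub_sq hn, sampleMean_sub_const hn]
  ring

lemma tendstoInMeasure_sampleVar (h : IsStandardizedIID P y μ) :
    TendstoInMeasure P (fun n ω => sampleVar 0 n fun t => y t ω) atTop fun _ => 1 := by
  have hzero := h.isBigOInProb_sampleVar_sub_one.tendstoInMeasure_zero tendsto_inv_sqrt_natCast
  simpa only [tendstoInMeasure_iff_norm, Pi.zero_apply, sub_zero] using hzero

lemma isBigOInProb_lagSum_sqDev_sub (h : IsStandardizedIID P y μ) {τ : ℕ} (hτ : 1 ≤ τ) :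
    IsBigOInProb P atTop (fun n ω =>
      lagSum τ (n - τ) (sqDev n fun t => y t ω) (sqDev n fun t => y t ω)
        - (n - τ : ℕ) * sampleVar 0 n (fun t => y t ω) ^ 2
        - lagSum τ n (fun t => y t ω ^ 2 - 1) fun t => y t ω ^ 2 - 1) 1 := by
  have := h.isFiniteMeasure
  have hp := h.isBigOInProb_sampleMean.const_mul 2
  have hq := h.isBigOInProb_sampleMean_sq_sub_one.sub (h.isBigOInProb_sampleMean_sq.const_mul 2)
  have hp1 := hp.of_tendsto_zero tendsto_inv_sqrt_natCast
  have hq1 := hq.of_tendsto_zero tendsto_inv_sqrt_natCast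
  have hS := isBigOInProb_one_of_tendstoInMeasure h.tendstoInMeasure_sampleVar
  have hIco (n : ℕ) : (Finset.Ico (n - τ) n).card ≤ τ := by simp; omega
  have hlast := isBigOInProb_one_sum (isOrthogonalBounded_comp_mul_comp h.iIndepFun h.hasLaw
    (f := fun x => x ^ 2 - 1) (g := fun x => x ^ 2 - 1) (by fun_prop) (by fun_prop)
    h.memLp_sq_sub_one h.memLp_sq_sub_one h.integral_sq_sub_one hτ) hIco
  have hedge := hS.one_mul ((h.isBigOInProb_one_sum_sub_mul_sub hp1 hq1 hIco).add
    (h.isBigOInProb_one_sum_sub_mul_sub hp1 hq1 (I := fun _ => Finset.range τ) (K := τ)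
      fun _ => (Finset.card_range τ).le))
  refine (((h.isBigOInProb_lagSum_sub_mul_sub hτ hp hq).sub hedge).sub hlast).congr' ?_
  filter_upwards [eventually_ge_atTop τ] with n hn ω
  have hn0 : n ≠ 0 := by omega
  have hmean : sampleMean n (sqDev n fun t => y t ω) = sampleVar 0 n fun t => y t ω :=
    (sampleVar_zero_eq_sampleMean n _).symm
  have hsplit : lagSum τ n (fun t => y t ω ^ 2 - 1) (fun t => y t ω ^ 2 - 1)
      = lagSum τ (n - τ) (fun t => y t ω ^ 2 - 1) (fun t => y t ω ^ 2 - 1)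
        + ∑ t ∈ Finset.Ico (n - τ) n, (y t ω ^ 2 - 1) * (y (t + τ) ω ^ 2 - 1) :=
    (Finset.sum_range_add_sum_Ico _ (Nat.sub_le n τ)).symm
  rw [lagSum_self_eq_lagSum_sub_sampleMean hn hn0 (sqDev n fun t => y t ω), hmean, hsplit]
  simp only [sqDev_sub_sampleVar hn0]
  ring

end IsStandardizedIID

end SampleMomentExpansion

section ScaledLagMoment

/-- The lag-`τ` sample moment of the squares of the standardized series, centred at its value `1`
under independence and scaled by `√n`. Up to the factor `1 / 2` these are the coordinates of the
vector whose squared length is the statistic. -/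
noncomputable def scaledLagMoment (d τ n : ℕ) (x : ℕ → ℝ) : ℝ :=
  √(n : ℝ) * ((∑ t ∈ Finset.range (n - τ),
    standardized d n x t ^ 2 * standardized d n x (t + τ) ^ 2) / ((n : ℝ) - τ) - 1)

lemma volatilityStat_eq_sum_scaledLagMoment_sq (d : ℕ) (T : Finset ℕ) (n : ℕ) (x : ℕ → ℝ) :
    volatilityStat d T n x = ∑ τ ∈ T, scaledLagMoment d τ n x ^ 2 / 4 := by
  simp only [volatilityStat, scaledLagMoment, mul_pow, Real.sq_sqrt (Nat.cast_nonneg n),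
    Finset.mul_sum, mul_div_assoc]

lemma sum_standardized_sq_mul_standardized_sq {d n : ℕ} (hd : d ≤ n) (hn : n ≠ 0) (τ : ℕ)
    (x : ℕ → ℝ) :
    ∑ t ∈ Finset.range (n - τ), standardized d n x t ^ 2 * standardized d n x (t + τ) ^ 2
      = lagSum τ (n - τ) (sqDev n x) (sqDev n x)
        * (((n : ℝ) / (n - d) * sampleVar 0 n x) ^ 2)⁻¹ := by
  rw [lagSum, Finset.sum_mul]
  refine Finset.sum_congr rfl fun t _ => ?_
  rw [standardized_sq hd, standardized_sq hd, sampleVar_eq_sampleVar_zero_mul hn, sqDev, sqDev,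
    div_mul_div_comm, ← sq, mul_comm (sampleVar 0 n x), div_eq_mul_inv]

lemma scaledLagMoment_sub_eq {d τ n : ℕ} (hd : d ≤ n) (hτ : τ < n) (x : ℕ → ℝ) (L : ℝ) :
    scaledLagMoment d τ n x - (√(n : ℝ))⁻¹ * L
      = ((n : ℝ) / (n - d))⁻¹ ^ 2
          * (√(n : ℝ) * (sampleVar 0 n x ^ 2 * (sampleVar 0 n x ^ 2)⁻¹ - 1))
        + √(n : ℝ) * (((n : ℝ) / (n - d))⁻¹ ^ 2 - 1)
        + (((n : ℝ) / (n - d))⁻¹ ^ 2 * (n / (n - τ)) * (sampleVar 0 n x ^ 2)⁻¹ - 1)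
          * ((√(n : ℝ))⁻¹ * L)
        + (√(n : ℝ))⁻¹ * (lagSum τ (n - τ) (sqDev n x) (sqDev n x)
            - (n - τ : ℕ) * sampleVar 0 n x ^ 2 - L)
          * (((n : ℝ) / (n - d))⁻¹ ^ 2 * (n / (n - τ)) * (sampleVar 0 n x ^ 2)⁻¹) := by
  have hn : 0 < (n : ℝ) := by exact_mod_cast (Nat.zero_le τ).trans_lt hτ
  have hτ' : (n : ℝ) - τ ≠ 0 := sub_ne_zero.2 (by exact_mod_cast hτ.ne')
  have hsqrt : √(n : ℝ) ^ 2 = n := Real.sq_sqrt hn.le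
  have hsqrt0 : √(n : ℝ) ≠ 0 := (Real.sqrt_pos.2 hn).ne'
  rw [scaledLagMoment, sum_standardized_sq_mul_standardized_sq hd (by omega), mul_pow, mul_inv,
    inv_pow, Nat.cast_sub hτ.le]
  generalize (((n : ℝ) / (n - d)) ^ 2)⁻¹ = r
  generalize (sampleVar 0 n x ^ 2)⁻¹ = s
  field_simp
  rw [hsqrt]
  ring

lemma tendsto_natCast_div_sub (a : ℕ) :
    Tendsto (fun n : ℕ => (n : ℝ) / (n - a)) atTop (nhds 1) := by
  simpa only [sub_eq_add_neg] using tendsto_natCast_div_add_atTop (-(a : ℝ))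

lemma tendsto_sqrt_mul_inv_sq_sub_one (d : ℕ) :
    Tendsto (fun n : ℕ => √(n : ℝ) * (((n : ℝ) / (n - d))⁻¹ ^ 2 - 1)) atTop (nhds 0) := by
  have h : Tendsto (fun n : ℕ => -2 * (d : ℝ) * (√(n : ℝ))⁻¹ + (d : ℝ) ^ 2 * (√(n : ℝ))⁻¹ ^ 3)
      atTop (nhds (-2 * (d : ℝ) * 0 + d ^ 2 * 0 ^ 3)) :=
    (tendsto_inv_sqrt_natCast.const_mul _).add ((tendsto_inv_sqrt_natCast.pow 3).const_mul _)
  rw [show -2 * (d : ℝ) * 0 + d ^ 2 * 0 ^ 3 = 0 by ring] at h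
  refine h.congr' ?_
  filter_upwards [eventually_ne_atTop 0] with n hn
  have hn' : 0 < (n : ℝ) := by exact_mod_cast Nat.pos_of_ne_zero hn
  have hsqrt0 : √(n : ℝ) ≠ 0 := (Real.sqrt_pos.2 hn').ne'
  have hsqrt : (n : ℝ) = √(n : ℝ) ^ 2 := (Real.sq_sqrt hn'.le).symm
  rw [inv_div]
  generalize √(n : ℝ) = r at *
  rw [hsqrt]
  field_simp
  ring

end ScaledLagMoment

section ScaledLagMomentExpansion

variable {Ω : Type*} [MeasurableSpace Ω] {P : Measure Ω} {y : ℕ → Ω → ℝ} {μ : Measure ℝ}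

namespace IsStandardizedIID

lemma tendstoInMeasure_const_mul_sampleVar_inv (h : IsStandardizedIID P y μ) {κ : ℕ → ℝ}
    (hκ : Tendsto κ atTop (nhds 1)) :
    TendstoInMeasure P (fun n ω => κ n * (sampleVar 0 n (fun t => y t ω) ^ 2)⁻¹ - 1) atTop 0 := by
  have hinv : TendstoInMeasure P (fun n ω => (sampleVar 0 n (fun t => y t ω) ^ 2)⁻¹ - 1)
      atTop 0 := by
    have hcont : ContinuousAt (fun s : ℝ => (s ^ 2)⁻¹ - 1) 1 := by fun_prop (disch := norm_num)
    have hcomp := tendstoInMeasure_comp_of_continuousAt hcont h.tendstoInMeasure_sampleVar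
    rwa [show (fun _ : Ω => ((1 : ℝ) ^ 2)⁻¹ - 1) = 0 by ext; simp] at hcomp
  have hκ' : TendstoInMeasure P (fun n _ => κ n - 1) atTop 0 :=
    tendstoInMeasure_of_tendsto (a := 0) ((hκ.sub_const 1).trans_eq (by simp))
  have hadd := tendstoInMeasure_zero_add
    (tendstoInMeasure_zero_mul hinv (isBigOInProb_one_of_tendstoInMeasure
      (tendstoInMeasure_of_tendsto hκ))) hκ'
  refine hadd.congr_left fun n => ae_of_all _ fun ω => ?_
  ring

lemma tendstoInMeasure_mul_sampleVar_mul_inv_sub_one (h : IsStandardizedIID P y μ)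
    (a b : ℕ → ℝ) :
    TendstoInMeasure P (fun n ω => a n * (b n
      * (sampleVar 0 n (fun t => y t ω) ^ 2 * (sampleVar 0 n (fun t => y t ω) ^ 2)⁻¹ - 1)))
      atTop 0 := by
  refine tendstoInMeasure_zero_of_eqOn (isOpen_ne.mem_nhds one_ne_zero)
    h.tendstoInMeasure_sampleVar fun n ω (hS : sampleVar 0 n (fun t => y t ω) ≠ 0) => ?_
  rw [mul_inv_cancel₀ (pow_ne_zero 2 hS), sub_self, mul_zero, mul_zero]

lemma isBigOInProb_inv_sqrt_mul_lagSum (h : IsStandardizedIID P y μ) {τ : ℕ} (hτ : 1 ≤ τ) :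
    IsBigOInProb P atTop (fun (n : ℕ) ω => (√(n : ℝ))⁻¹
      * lagSum τ n (fun t => y t ω ^ 2 - 1) fun t => y t ω ^ 2 - 1) 1 := by
  have hlag := h.isBigOInProb_lagSum (f := fun x => x ^ 2 - 1) (g := fun x => x ^ 2 - 1)
    (by fun_prop) (by fun_prop) h.memLp_sq_sub_one h.memLp_sq_sub_one h.integral_sq_sub_one hτ
    (N := id) fun n => le_rfl
  exact IsBigOInProb.inv_mul (.of_abs_le (.of_forall fun _ => le_rfl)) hlag

lemma tendstoInMeasure_scaledLagMoment_sub (h : IsStandardizedIID P y μ) (d : ℕ) {τ : ℕ}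
    (hτ : 1 ≤ τ) :
    TendstoInMeasure P (fun n ω => scaledLagMoment d τ n (fun t => y t ω)
      - (√(n : ℝ))⁻¹ * lagSum τ n (fun t => y t ω ^ 2 - 1) fun t => y t ω ^ 2 - 1) atTop 0 := by
  have hκ : Tendsto (fun n : ℕ => ((n : ℝ) / (n - d))⁻¹ ^ 2 * (n / (n - τ))) atTop (nhds 1) := by
    simpa using (((tendsto_natCast_div_sub d).inv₀ one_ne_zero).pow 2).mul
      (tendsto_natCast_div_sub τ)
  have hA : IsBigOInProb P atTop (fun (n : ℕ) ω => (√(n : ℝ))⁻¹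
      * lagSum τ n (fun t => y t ω ^ 2 - 1) fun t => y t ω ^ 2 - 1) 1 :=
    h.isBigOInProb_inv_sqrt_mul_lagSum hτ
  have hR : TendstoInMeasure P (fun (n : ℕ) ω => (√(n : ℝ))⁻¹
      * (lagSum τ (n - τ) (sqDev n fun t => y t ω) (sqDev n fun t => y t ω)
        - (n - τ : ℕ) * sampleVar 0 n (fun t => y t ω) ^ 2
        - lagSum τ n (fun t => y t ω ^ 2 - 1) fun t => y t ω ^ 2 - 1)) atTop 0 :=
    tendstoInMeasure_zero_mul (tendstoInMeasure_of_tendsto (a := 0) tendsto_inv_sqrt_natCast)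
      (h.isBigOInProb_lagSum_sqDev_sub hτ)
  have hw := h.tendstoInMeasure_const_mul_sampleVar_inv hκ
  have hw1 : IsBigOInProb P atTop (fun (n : ℕ) ω => ((n : ℝ) / (n - d))⁻¹ ^ 2 * (n / (n - τ))
      * (sampleVar 0 n (fun t => y t ω) ^ 2)⁻¹) 1 :=
    ((isBigOInProb_one_of_tendstoInMeasure hw).add (.const_one 1)).congr'
      (.of_forall fun n ω => sub_add_cancel _ _)
  have hsum := tendstoInMeasure_zero_add (tendstoInMeasure_zero_add (tendstoInMeasure_zero_add
    (h.tendstoInMeasure_mul_sampleVar_mul_inv_sub_one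
      (fun n => ((n : ℝ) / (n - d))⁻¹ ^ 2) fun n => √(n : ℝ))
    (tendstoInMeasure_of_tendsto (a := 0) (tendsto_sqrt_mul_inv_sq_sub_one d)))
    (tendstoInMeasure_zero_mul hw hA)) (tendstoInMeasure_zero_mul hR hw1)
  refine hsum.congr' ?_ ae_eq_rfl
  filter_upwards [eventually_gt_atTop τ, eventually_ge_atTop d] with n hn hd
  exact ae_of_all _ fun ω => (scaledLagMoment_sub_eq hd hn _ _).symm

end IsStandardizedIID

end ScaledLagMomentExpansion

section ChiSquaredLimit

lemma identDistrib_norm_sq_stdGaussian (E : Type*) [NormedAddCommGroup E] [InnerProductSpace ℝ E]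
    [FiniteDimensional ℝ E] [MeasurableSpace E] [BorelSpace E] :
    IdentDistrib (fun z : E => ‖z‖ ^ 2) id (stdGaussian E) (chiSquared (Module.finrank ℝ E)) where
  aemeasurable_fst := by fun_prop
  aemeasurable_snd := by fun_prop
  map_eq := by
    rw [← stdGaussian_map (stdOrthonormalBasis ℝ E).repr.symm, ← map_pi_eq_stdGaussian,
      Measure.map_map (by fun_prop) (by fun_prop), Measure.map_map (by fun_prop) (by fun_prop),
      Measure.map_id, chiSquared]
    congr 1 with z
    simp [EuclideanSpace.real_norm_sq_eq]

lemma tendstoInDistribution_of_identDistrib_limit {ι Ω Ω₁ Ω₂ E : Type*} [MeasurableSpace Ω]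
    [MeasurableSpace Ω₁] [MeasurableSpace Ω₂] [TopologicalSpace E] [MeasurableSpace E]
    [OpensMeasurableSpace E] {P : Measure Ω} [IsProbabilityMeasure P] {P₁ : Measure Ω₁}
    [IsProbabilityMeasure P₁] {P₂ : Measure Ω₂} [IsProbabilityMeasure P₂] {l : Filter ι}
    {X : ι → Ω → E} {Z : Ω₁ → E} {W : Ω₂ → E}
    (hX : TendstoInDistribution X l Z (fun _ => P) P₁) (hZW : IdentDistrib Z W P₁ P₂) :
    TendstoInDistribution X l W (fun _ => P) P₂ where
  forall_aemeasurable := hX.forall_aemeasurable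
  aemeasurable_limit := hZW.aemeasurable_snd
  tendsto := by simpa only [hZW.map_eq] using hX.tendsto

variable {Ω : Type*} [MeasurableSpace Ω] {P : Measure Ω} {y : ℕ → Ω → ℝ} {μ : Measure ℝ}
  {T : Finset ℕ}

namespace IsStandardizedIID

lemma tendstoInMeasure_volatilityStat_sub (h : IsStandardizedIID P y μ) (hT : ∀ τ ∈ T, 1 ≤ τ)
    (d : ℕ) :
    TendstoInMeasure P (fun n ω => volatilityStat d T n (fun t => y t ω)
      - ‖laggedVector (Subtype.val : T → ℕ) n fun t => y t ω ^ 2 - 1‖ ^ 2 / 4) atTop 0 := by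
  have hlag (τ : ℕ) (hτ : τ ∈ T) : TendstoInMeasure P (fun n ω =>
      (scaledLagMoment d τ n (fun t => y t ω)
        - (√(n : ℝ))⁻¹ * lagSum τ n (fun t => y t ω ^ 2 - 1) fun t => y t ω ^ 2 - 1)
      * (4⁻¹ * (scaledLagMoment d τ n (fun t => y t ω)
          - (√(n : ℝ))⁻¹ * lagSum τ n (fun t => y t ω ^ 2 - 1) fun t => y t ω ^ 2 - 1)
        + 2⁻¹ * ((√(n : ℝ))⁻¹ * lagSum τ n (fun t => y t ω ^ 2 - 1) fun t => y t ω ^ 2 - 1)))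
      atTop 0 := by
    have hsub := h.tendstoInMeasure_scaledLagMoment_sub d (hT τ hτ)
    exact tendstoInMeasure_zero_mul hsub
      (((isBigOInProb_one_of_tendstoInMeasure hsub).const_mul _).add
        ((h.isBigOInProb_inv_sqrt_mul_lagSum (hT τ hτ)).const_mul _))
  refine (tendstoInMeasure_zero_sum hlag).congr_left fun n => ae_of_all _ fun ω => ?_
  simp only [volatilityStat_eq_sum_scaledLagMoment_sq, EuclideanSpace.real_norm_sq_eq,
    laggedVector, Finset.sum_div]
  rw [Finset.sum_coe_sort T fun τ => ((√(n : ℝ))⁻¹ * ∑ t ∈ Finset.range n,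
    (y t ω ^ 2 - 1) * (y (t + τ) ω ^ 2 - 1)) ^ 2 / 4, ← Finset.sum_sub_distrib]
  refine Finset.sum_congr rfl fun τ _ => ?_
  rw [lagSum]
  ring

lemma hasLaw_sq_sub_one (h : IsStandardizedIID P y μ) (t : ℕ) :
    HasLaw (fun ω => y t ω ^ 2 - 1) (μ.map fun x => x ^ 2 - 1) P :=
  HasLaw.comp (Y := fun x => x ^ 2 - 1) ⟨by fun_prop, rfl⟩ (h.hasLaw t)

lemma tendstoInDistribution_laggedVector_sq_sub_one [IsProbabilityMeasure P]
    (h : IsStandardizedIID P y μ) (h6 : MemLp id 6 μ) (hT : ∀ τ ∈ T, 1 ≤ τ) :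
    TendstoInDistribution
      (fun n ω => laggedVector (Subtype.val : T → ℕ) n fun t => y t ω ^ 2 - 1) atTop
      (fun z => (∫ x, (x ^ 2 - 1) ^ 2 ∂μ) • z) (fun _ => P)
      (stdGaussian (EuclideanSpace ℝ T)) := by
  have hprob := h.isProbabilityMeasure_law
  have hmeas : Measurable fun x : ℝ => x ^ 2 - 1 := by fun_prop
  have hmemLp : MemLp id 3 (μ.map fun x => x ^ 2 - 1) :=
    (memLp_map_measure_iff (by fun_prop) hmeas.aemeasurable).2
      (memLp_sq_sub_one_of_memLp_id (by norm_num; exact h6))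
  have hmean : ∫ x, x ∂(μ.map fun x => x ^ 2 - 1) = 0 := by
    rw [integral_map hmeas.aemeasurable (by fun_prop), h.integral_sq_sub_one]
  have hlim := tendstoInDistribution_laggedVector (τ := (Subtype.val : T → ℕ))
    (h.iIndepFun.comp (fun _ x => x ^ 2 - 1) fun _ => hmeas) h.hasLaw_sq_sub_one hmemLp hmean
    (fun τ => hT τ τ.2) Subtype.val_injective
  rwa [integral_map hmeas.aemeasurable (by fun_prop)] at hlim

lemma tendstoInDistribution_volatilityStat [IsProbabilityMeasure P] (h : IsStandardizedIID P y μ)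
    (h6 : MemLp id 6 μ) (hT : ∀ τ ∈ T, 1 ≤ τ) (d : ℕ) :
    TendstoInDistribution (fun n ω => volatilityStat d T n fun t => y t ω) atTop
      (fun q => ((∫ x, (x ^ 2 - 1) ^ 2 ∂μ) / 2) ^ 2 * q) (fun _ => P) (chiSquared T.card) := by
  have hlim := (h.tendstoInDistribution_laggedVector_sq_sub_one h6 hT).continuous_comp
    (g := fun z => ‖z‖ ^ 2 / 4) (by fun_prop)
  have hchi : IdentDistrib
      ((fun z => ‖z‖ ^ 2 / 4) ∘ fun z : EuclideanSpace ℝ T => (∫ x, (x ^ 2 - 1) ^ 2 ∂μ) • z)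
      (fun q => ((∫ x, (x ^ 2 - 1) ^ 2 ∂μ) / 2) ^ 2 * q)
      (stdGaussian (EuclideanSpace ℝ T)) (chiSquared T.card) := by
    have hnorm := (identDistrib_norm_sq_stdGaussian (EuclideanSpace ℝ T)).comp
      (u := fun q => ((∫ x, (x ^ 2 - 1) ^ 2 ∂μ) / 2) ^ 2 * q) (by fun_prop)
    rw [finrank_euclideanSpace, Fintype.card_coe] at hnorm
    convert! hnorm using 1
    ext z
    simp only [Function.comp_apply, norm_smul, mul_pow, Real.norm_eq_abs, sq_abs]
    ring
  refine tendstoInDistribution_of_tendstoInMeasure_sub _ _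
    (tendstoInDistribution_of_identDistrib_limit hlim hchi)
    (h.tendstoInMeasure_volatilityStat_sub hT d) fun n => ?_
  exact (measurable_volatilityStat d T n).comp_aemeasurable
    (aemeasurable_pi_iff.2 fun t => (h.hasLaw t).aemeasurable)

end IsStandardizedIID

end ChiSquaredLimit

section Kurtosis

/-- The kurtosis of a law on the real line, its fourth central moment divided by the square of its
variance. It is not the excess kurtosis: Gaussian laws have kurtosis `3`. -/
noncomputable def kurtosis (μ : Measure ℝ) : ℝ := centralMoment id 4 μ / Var[id; μ] ^ 2

variable {μ : Measure ℝ}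

lemma integral_sq_sub_integral : ∫ x, (x - ∫ z, z ∂μ) ^ 2 ∂μ = Var[id; μ] :=
  (variance_eq_integral aemeasurable_id).symm

lemma integral_pow_four_sub_integral_div_sqrt_variance :
    ∫ x, ((x - ∫ z, z ∂μ) / √Var[id; μ]) ^ 4 ∂μ = kurtosis μ := by
  simp only [div_pow, integral_div, kurtosis, centralMoment]
  rw [show √Var[id; μ] ^ 4 = (√Var[id; μ] ^ 2) ^ 2 by ring, Real.sq_sqrt (variance_nonneg _ _)]
  rfl

variable {Ω : Type*} [MeasurableSpace Ω] {P : Measure Ω} {x : ℕ → Ω → ℝ}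

lemma memLp_id_map_sub_div [IsFiniteMeasure μ] {p : ENNReal} (hμ : MemLp id p μ) (a s : ℝ) :
    MemLp id p (μ.map fun x => (x - a) / s) :=
  (memLp_map_measure_iff (by fun_prop) (by fun_prop)).2 (by
    simpa only [Function.comp_def, Pi.sub_apply, id, div_eq_mul_inv]
      using (hμ.sub (memLp_const a)).mul_const s⁻¹)

lemma isStandardizedIID_sub_div_sqrt_variance (hindep : iIndepFun x P)
    (hlaw : ∀ t, HasLaw (x t) μ P) (hμ : MemLp id 4 μ) (hv : Var[id; μ] ≠ 0) :
    IsStandardizedIID P (fun t ω => (x t ω - ∫ z, z ∂μ) / √Var[id; μ])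
      (μ.map fun x => (x - ∫ z, z ∂μ) / √Var[id; μ]) := by
  have hprob : IsProbabilityMeasure μ :=
    (hlaw 0).isProbabilityMeasure_iff.1 hindep.isProbabilityMeasure
  have hvar : 0 < Var[id; μ] := (variance_nonneg _ _).lt_of_ne' hv
  have hmeas : Measurable fun x : ℝ => (x - ∫ z, z ∂μ) / √Var[id; μ] := by fun_prop
  have hint : Integrable (fun x => x) μ := hμ.integrable (by norm_num)
  exact {
    iIndepFun := hindep.comp (fun _ x => (x - ∫ z, z ∂μ) / √Var[id; μ]) fun _ => hmeas
    hasLaw t := HasLaw.comp (Y := fun x => (x - ∫ z, z ∂μ) / √Var[id; μ]) ⟨by fun_prop, rfl⟩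
      (hlaw t)
    memLp := memLp_id_map_sub_div hμ _ _
    integral_id := by
      rw [integral_map hmeas.aemeasurable (by fun_prop), integral_div,
        integral_sub hint (integrable_const _)]
      simp
    integral_sq := by
      rw [integral_map hmeas.aemeasurable (by fun_prop)]
      simp only [div_pow, Real.sq_sqrt hvar.le]
      rw [integral_div, integral_sq_sub_integral, div_self hv] }

lemma IsStandardizedIID.integral_sq_sub_one_sq (h : IsStandardizedIID P x μ) :
    ∫ x, (x ^ 2 - 1) ^ 2 ∂μ = (∫ x, x ^ 4 ∂μ) - 1 := by
  have hprob := h.isProbabilityMeasure_law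
  have hpow : Integrable (fun x : ℝ => x ^ 4) μ := by
    simpa [Even.pow_abs (show Even 4 by decide)] using h.memLp.integrable_norm_pow (by norm_num)
  have hsq : Integrable (fun x : ℝ => 2 * x ^ 2) μ := h.memLp_id_two.integrable_sq.const_mul 2
  have hsub : Integrable (fun x : ℝ => 2 * x ^ 2 - 1) μ := hsq.sub (integrable_const 1)
  calc ∫ x, (x ^ 2 - 1) ^ 2 ∂μ = ∫ x, (x ^ 4 - (2 * x ^ 2 - 1)) ∂μ := by congr with x; ring
    _ = (∫ x, x ^ 4 ∂μ) - (2 * ∫ x, x ^ 2 ∂μ - 1) := by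
      rw [integral_sub hpow hsub, integral_sub hsq (integrable_const 1),
        integral_const_mul, integral_const, probReal_univ, one_smul]
    _ = (∫ x, x ^ 4 ∂μ) - 1 := by
      rw [h.integral_sq]
      norm_num

end Kurtosis

section GaussianKurtosis

lemma deriv_mul_exp_half_mul_sq (v : ℝ) {p p' : ℝ → ℝ} (hp : ∀ t, HasDerivAt p (p' t) t) :
    deriv (fun t => p t * Real.exp (v * t ^ 2 / 2))
      = fun t => (p' t + p t * (v * t)) * Real.exp (v * t ^ 2 / 2) := by
  ext t
  have hquad : HasDerivAt (fun t : ℝ => v * t ^ 2 / 2) (v * t) t := by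
    convert! (((hasDerivAt_id t).pow 2).const_mul v).div_const 2 using 1
    simp
    ring
  rw [((hp t).fun_mul hquad.exp).deriv]
  ring

lemma iteratedDeriv_four_exp_half_mul_sq (v : ℝ) :
    iteratedDeriv 4 (fun t => Real.exp (v * t ^ 2 / 2)) 0 = 3 * v ^ 2 := by
  have hone : deriv (fun t => Real.exp (v * t ^ 2 / 2))
      = fun t => v * t * Real.exp (v * t ^ 2 / 2) := by
    simpa using deriv_mul_exp_half_mul_sq v fun t => hasDerivAt_const t (1 : ℝ)
  have hlin (t : ℝ) : HasDerivAt (fun t => v * t) v t := by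
    simpa using (hasDerivAt_id t).const_mul v
  have hquad (t : ℝ) : HasDerivAt (fun t => v + v * t * (v * t)) (2 * v ^ 2 * t) t := by
    convert! ((hlin t).fun_mul (hlin t)).const_add v using 1
    ring
  have hcubic (t : ℝ) : HasDerivAt (fun t => 2 * v ^ 2 * t + (v + v * t * (v * t)) * (v * t))
      (2 * v ^ 2 + (2 * v ^ 2 * t * (v * t) + (v + v * t * (v * t)) * v)) t := by
    convert! ((hasDerivAt_id t).const_mul (2 * v ^ 2)).fun_add ((hquad t).fun_mul (hlin t)) using 1
    ring
  rw [iteratedDeriv_succ, iteratedDeriv_succ, iteratedDeriv_succ, iteratedDeriv_one, hone,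
    deriv_mul_exp_half_mul_sq v hlin, deriv_mul_exp_half_mul_sq v hquad,
    deriv_mul_exp_half_mul_sq v hcubic]
  simp
  ring

lemma centralMoment_four_gaussianReal (m : ℝ) (v : NNReal) :
    centralMoment id 4 (gaussianReal m v) = 3 * v ^ 2 := by
  have hmgf := iteratedDeriv_mgf_zero (X := fun x : ℝ => x) (μ := gaussianReal 0 v) (by simp) 4
  simp only [mgf_fun_id_gaussianReal, zero_mul, zero_add, Pi.pow_apply] at hmgf
  rw [← iteratedDeriv_four_exp_half_mul_sq, hmgf, ← sub_self m, ← gaussianReal_map_sub_const,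
    integral_map (by fun_prop) (by fun_prop)]
  simp [centralMoment]

lemma kurtosis_gaussianReal (m : ℝ) {v : NNReal} (hv : v ≠ 0) :
    kurtosis (gaussianReal m v) = 3 := by
  rw [kurtosis, centralMoment_four_gaussianReal, variance_id_gaussianReal]
  field_simp

end GaussianKurtosis

theorem theorem3_general {Ω : Type*} [MeasurableSpace Ω] {P : Measure Ω} [IsProbabilityMeasure P]
    {x : ℕ → Ω → ℝ} {μ : Measure ℝ} (hindep : iIndepFun x P) (hlaw : ∀ t, HasLaw (x t) μ P)
    (hμ : MemLp id 6 μ) (hv : Var[id; μ] ≠ 0) {T : Finset ℕ} (hT : ∀ τ ∈ T, 1 ≤ τ) (d : ℕ) :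
    TendstoInDistribution (fun (n : ℕ) ω => volatilityStat d T n fun t => x t ω) atTop
      (fun q => ((kurtosis μ - 1) / 2) ^ 2 * q) (fun _ => P) (chiSquared T.card) := by
  have hprob : IsProbabilityMeasure μ := (hlaw 0).isProbabilityMeasure_iff.1 ‹_›
  have hsd : 0 < √Var[id; μ] := Real.sqrt_pos.2 ((variance_nonneg _ _).lt_of_ne' hv)
  have hstd := isStandardizedIID_sub_div_sqrt_variance hindep hlaw
    (hμ.mono_exponent (by norm_num)) hv
  have hlim := hstd.tendstoInDistribution_volatilityStat (memLp_id_map_sub_div hμ _ _) hT d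
  rw [hstd.integral_sq_sub_one_sq, integral_map (by fun_prop) (by fun_prop),
    integral_pow_four_sub_integral_div_sqrt_variance] at hlim
  simpa only [volatilityStat_sub_div d T _ _ hsd] using hlim

theorem theorem3 {Ω : Type*} [MeasurableSpace Ω] (P : Measure Ω) [IsProbabilityMeasure P]
    (x : ℕ → Ω → ℝ) (m : ℝ) (v : NNReal) (hv : v ≠ 0)
    (hindep : iIndepFun x P) (hlaw : ∀ t, HasLaw (x t) (gaussianReal m v) P)
    (T : Finset ℕ) (hT : ∀ τ ∈ T, 1 ≤ τ) (d : ℕ) (hd : d = 0 ∨ d = 1) :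
    TendstoInDistribution (fun (n : ℕ) (ω : Ω) => volatilityStat d T n (fun t => x t ω)) atTop
      (id : ℝ → ℝ) (fun _ => P) (chiSquared T.card) := by
  have hlim := theorem3_general hindep hlaw (memLp_id_gaussianReal' 6 (by norm_num))
    (by simpa [variance_id_gaussianReal] using hv) hT d
  norm_num [kurtosis_gaussianReal m hv] at hlim
  exact hlim
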